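/- Let $\omega$ be the exponent of matrix multiplication over $\mathbb{C}$: the infimum of all real $\tau$ for which there is a constant $b$ such that, for every $n$, two $n \times n$ matrices over $\mathbb{C}$ can be multiplied by an arithmetic circuit with at most $b\,n^{\tau}$ operations. For a finite group $G$ and a complete set $\mathrm{Irr}(G)$ of pairwise inequivalent irreducible complex matrix representations of $G$ (each written in some basis), the generalized DFT is the linear map $$(c_g)_{g\in G} \longmapsto \sum_{g \in G} c_g \bigoplus_{\rho \in \mathrm{Irr}(G)} \rho(g).$$ Here circuits are non-uniform arithmetic circuits over $\mathbb{C}$ (operations: addition, subtraction and multiplication; complex constants may be used as operands), and their cost is the number of operations. For a finite field $\mathbb{F}_q$, let $$\mathrm{Sp}_{2n}(\mathbb{F}_q) = \{A \in \mathrm{GL}_{2n}(\mathbb{F}_q) : A^T Q A = Q\}, \qquad Q = \begin{pmatrix} 0 & J \\ -J & 0 \end{pmatrix},$$ where $J$ is the $n \times n$ matrix with ones on the antidiagonal and zeros elsewhere. Theorem. For every $\epsilon > 0$ there is a constant $C_\epsilon$ such that for every $n \geq 0$ and every prime power $q$, the group $G = \mathrm{Sp}_{2n}(\mathbb{F}_q)$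 has a complete set of irreducible complex representations, and for every such set $\mathrm{Irr}(G)$ the generalized DFT of $G$ with respect to $\mathrm{Irr}(G)$ can be computed by an arithmetic circuit with at most $C_\epsilon\, |G|^{\omega/2 + \epsilon}$ operations. -/

import Mathlib

/-! ### Arithmetic circuits over `ℂ` -/

/-- The three arithmetic operations of a circuit. -/
inductive ArithOp : Type
  | add
  | sub
  | mul

/-- The value of an arithmetic operation. -/
def ArithOp.eval : ArithOp → ℂ → ℂ → ℂ
  | .add, a, b => a + b
  | .sub, a, b => a - b
  | .mul, a, b => a * b

/-- An operand available to a circuit with input variables `ι` after `s` operations: an input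
variable, a complex constant, or the result of one of the `s` operations performed so far. -/
inductive Operand (ι : Type*) (s : ℕ)
  | input (i : ι)
  | const (z : ℂ)
  | gate (j : Fin s)

/-- The value of an operand, given the inputs `x` and the results `v` of the operations. -/
def Operand.eval {ι : Type*} {s : ℕ} (x : ι → ℂ) (v : Fin s → ℂ) : Operand ι s → ℂ
  | .input i => x i
  | .const z => z
  | .gate j => v j

/-- An arithmetic circuit (straight-line program) with input variables `ι` that performs exactly
`s` arithmetic operations.  A circuit is built by appending operations one at a time, each applied
to two operands available at that moment. -/
inductive Circuit (ι : Type*) : ℕ → Type _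
  | nil : Circuit ι 0
  | snoc {s : ℕ} (P : Circuit ι s) (o : ArithOp) (a b : Operand ι s) : Circuit ι (s + 1)

/-- The results of the `s` operations of a circuit on the inputs `x`. -/
noncomputable def Circuit.eval {ι : Type*} (x : ι → ℂ) : {s : ℕ} → Circuit ι s → Fin s → ℂ
  | _, .nil => Fin.elim0
  | _, .snoc P o a b =>
      Fin.snoc (α := fun _ => ℂ) (P.eval x) (o.eval (a.eval x (P.eval x)) (b.eval x (P.eval x)))

/-- The circuit `P` computes the map `f`: each coordinate of `f` can be read off at an input
variable, at a constant, or at an operation of the circuit. -/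
def Circuit.Computes {ι κ : Type*} {s : ℕ} (P : Circuit ι s) (f : (ι → ℂ) → κ → ℂ) : Prop :=
  ∃ out : κ → Operand ι s, ∀ x k, (out k).eval x (P.eval x) = f x k

/-! ### The exponent of matrix multiplication -/

/-- Multiplication of `n × n` matrices over `ℂ`, as a map from the `2 n ^ 2` entries of the two
factors to the `n ^ 2` entries of the product. -/
noncomputable def matMulMap (n : ℕ) (x : (Fin n × Fin n) ⊕ (Fin n × Fin n) → ℂ) :
    Fin n × Fin n → ℂ :=
  fun p => (Matrix.of (fun i j => x (.inl (i, j))) * Matrix.of (fun i j => x (.inr (i, j))) :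
    Matrix (Fin n) (Fin n) ℂ) p.1 p.2

/-- The exponent `ω` of matrix multiplication over `ℂ`: the infimum of all real `τ` such that, for
some constant `b` and all `n`, two `n × n` matrices can be multiplied with at most `b * n ^ τ`
arithmetic operations. -/
noncomputable def matMulExponent : ℝ :=
  sInf {τ : ℝ | ∃ b : ℝ, ∀ n : ℕ, ∃ (s : ℕ) (P : Circuit ((Fin n × Fin n) ⊕ (Fin n × Fin n)) s),
    P.Computes (matMulMap n) ∧ (s : ℝ) ≤ b * (n : ℝ) ^ τ}

/-! ### The generalized DFT -/

/-- The representation on `ℂ ^ d` given by a matrix representation of degree `d`. -/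
noncomputable def matrixRep {G : Type*} [Group G] {d : ℕ} (ρ : G →* Matrix (Fin d) (Fin d) ℂ) :
    Representation ℂ G (Fin d → ℂ) :=
  (Matrix.toLinAlgEquiv' : Matrix (Fin d) (Fin d) ℂ ≃ₐ[ℂ] _).toMonoidHom.comp ρ

/-- A complete set `Irr(G)` of irreducible complex representations of `G`, each written in a basis:
finitely many irreducible matrix representations, pairwise inequivalent, such that every
irreducible matrix representation of `G` is equivalent to one of them. -/
structure CompleteIrreps (G : Type*) [Group G] where
  /-- the number of representations -/
  num : ℕ
  /-- their degrees -/
  dim : Fin num → ℕ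
  /-- the representations -/
  rep : (i : Fin num) → G →* Matrix (Fin (dim i)) (Fin (dim i)) ℂ
  irreducible : ∀ i, (matrixRep (rep i)).IsIrreducible
  inequivalent : ∀ i j, i ≠ j → IsEmpty ((matrixRep (rep i)).Equiv (matrixRep (rep j)))
  complete : ∀ (d : ℕ) (ρ : G →* Matrix (Fin d) (Fin d) ℂ), (matrixRep ρ).IsIrreducible →
    ∃ i, Nonempty ((matrixRep ρ).Equiv (matrixRep (rep i)))

/-- The generalized DFT with respect to `R`: the linear map that takes `c`, an element of the group
algebra given by its coefficients, to the entries of the blocks `∑ g, c g • ρ g`, for `ρ` in `R`. -/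
noncomputable def CompleteIrreps.dft {G : Type*} [Group G] [Fintype G] (R : CompleteIrreps G)
    (c : G → ℂ) : (Σ i : Fin R.num, Fin (R.dim i) × Fin (R.dim i)) → ℂ :=
  fun p => (∑ g : G, c g • R.rep p.1 g) p.2.1 p.2.2

/-! ### The symplectic group -/

/-- The `n × n` matrix with ones on the antidiagonal and zeros elsewhere. -/
def antidiagOne (n : ℕ) (F : Type*) [Field F] : Matrix (Fin n) (Fin n) F :=
  Matrix.of fun i j => if j = Fin.rev i then 1 else 0

/-- The matrix `Q = [[0, J], [-J, 0]]` of the symplectic form, with `J` the antidiagonal matrix. -/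
def sympForm (n : ℕ) (F : Type*) [Field F] : Matrix (Fin n ⊕ Fin n) (Fin n ⊕ Fin n) F :=
  Matrix.fromBlocks 0 (antidiagOne n F) (-antidiagOne n F) 0

/-- The symplectic group `Sp_{2n}(F)`: all invertible `2n × 2n` matrices `A` with `Aᵀ Q A = Q`. -/
def Sp (n : ℕ) (F : Type*) [Field F] : Subgroup (GL (Fin n ⊕ Fin n) F) where
  carrier := {A | A.1.transpose * sympForm n F * A.1 = sympForm n F}
  one_mem' := by simp
  mul_mem' := by
    intro A B hA hB
    simp only [Set.mem_ofPred_eq] at hA hB ⊢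
    calc (A * B).1.transpose * sympForm n F * (A * B).1
        = B.1.transpose * (A.1.transpose * sympForm n F * A.1) * B.1 := by
          simp [Matrix.mul_assoc, Matrix.transpose_mul]
      _ = sympForm n F := by rw [hA, hB]
  inv_mem' := by
    intro A hA
    simp only [Set.mem_ofPred_eq] at hA ⊢
    have h1 : A.1 * (A⁻¹).1 = 1 := A.mul_inv
    have h2 : (A⁻¹).1.transpose * A.1.transpose = 1 := by
      rw [← Matrix.transpose_mul, h1, Matrix.transpose_one]
    calc (A⁻¹).1.transpose * sympForm n F * (A⁻¹).1
        = (A⁻¹).1.transpose * (A.1.transpose * sympForm n F * A.1) * (A⁻¹).1 := by rw [hA]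
      _ = ((A⁻¹).1.transpose * A.1.transpose) * sympForm n F * (A.1 * (A⁻¹).1) := by
          simp only [Matrix.mul_assoc]
      _ = sympForm n F := by rw [h1, h2, Matrix.one_mul, Matrix.mul_one]

noncomputable instance (n : ℕ) (F : Type*) [Field F] [Finite F] : Fintype (Sp n F) :=
  Fintype.ofFinite _

/-!
The DFT of a finite group is computed in exponent `ω / 2` whenever the group is, up to few
translates, a product of subgroups that are all at most about as large as its square root. For the
symplectic group these are the three factors of the open cell of the Siegel parabolic.

*Double subgroup reduction* (`MatMulBound.doubleReduction`). Let `H` and `K` be groups mapped to `G`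
with `|H| |K| ≤ |G|`, and let `c` be a function on `H × K`. Write the restriction of each irreducible
representation `ρ` of `G` to `H` as `S (⨁ σ) S⁻¹`, and its restriction to `K` as `T (⨁ π) T⁻¹`. Then
`∑ c(h, k) ρ(h) ρ(k) = S (∑ c(h, k) (⨁ σ(h)) M (⨁ π(k))) T⁻¹` with `M = S⁻¹ T`. After the DFTs over
`H` and `K`, the `(σ, π)` blocks of the inner sums, for all `ρ`, come from one product of a constant
matrix with `N` rows, where `N` counts these blocks, and the square matrix of size `d = dim σ dim π`
that holds the entries of `∑ c(h, k) σ(h) ⊗ π(k)`. As `d ^ 2 ≤ |G|`, `∑ d ^ 2 ≤ |H| |K|` and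
`∑ N d = ∑ (dim ρ) ^ 2 ≤ |G|`, all these products, like the changes of basis, cost
`O(|G| ^ (τ / 2))` when square matrices are multiplied in `O(n ^ τ)`
(`MatMulBound.blockTransform`, `MatMulBound.sandwichFamily`).

*No recursion is needed* for the DFTs over the factors: many are wanted at a time, and then the
product with the matrix of the DFT is good enough as soon as the factor has at most `√|G|` elements
(`MatMulBound.batchDft`). The reduction is used for `P = N A` inside the Siegel parabolic and then
for `P V` inside `G`, where `A` is `GL_n` and `N`, `V` are the upper and lower unipotent groups of
symmetric matrices (`MatMulBound.dft_of_triple_cover`).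

*Covering* (`Siegel.exists_cover`). The open cell `N A V` consists of the symplectic matrices
`[[A, B], [C, D]]` with `D` invertible. A Lagrangian subspace always has a coordinate Lagrangian as
a complement, so `2 ^ n` signed permutation matrices move every symplectic matrix into the cell, and
`2 ^ n` is `O(|G| ^ ε)` because `|G| ≥ 2 ^ (n ^ 2)`.

The facts from representation theory are Maschke's theorem, which gives the adapted bases
(`CompleteIrreps.exists_conj_sumRep`), and Schur orthogonality, which gives `∑ (dim ρ) ^ 2 ≤ |G|` and
with it the existence of a complete set of irreducible representations.
-/

universe u v w

/-! ### A calculus of circuit costs -/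

/-- Rewriting an operand of an inner circuit, whose `t` gates are appended after the `s` gates of
an outer one and whose inputs are the operands `sub` of the outer circuit. -/
def Operand.subst {ι : Type u} {κ : Type v} {s t : ℕ} (sub : κ → Operand ι s) :
    Operand κ t → Operand ι (s + t)
  | .input k =>
      match sub k with
      | .input i => .input i
      | .const z => .const z
      | .gate j => .gate (Fin.castAdd t j)
  | .const z => .const z
  | .gate j => .gate (Fin.natAdd s j)

/-- Appending the circuit `Q` to `P`, with the inputs of `Q` read off at the operands `sub`. -/
def Circuit.append {ι : Type u} {κ : Type v} {s : ℕ} (P : Circuit ι s) (sub : κ → Operand ι s) :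
    {t : ℕ} → Circuit κ t → Circuit ι (s + t)
  | _, .nil => P
  | _, .snoc Q o a b => .snoc (P.append sub Q) o (a.subst sub) (b.subst sub)

theorem Operand.eval_subst {ι : Type u} {κ : Type v} {s t : ℕ} (sub : κ → Operand ι s)
    (x : ι → ℂ) (p : Fin s → ℂ) (q : Fin t → ℂ) (pq : Fin (s + t) → ℂ)
    (hp : ∀ j, pq (Fin.castAdd t j) = p j) (hq : ∀ j, pq (Fin.natAdd s j) = q j)
    (o : Operand κ t) :
    (o.subst sub).eval x pq = o.eval (fun k => (sub k).eval x p) q := by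
  cases o with
  | input k =>
    simp only [Operand.subst, Operand.eval]
    cases sub k <;> simp [hp]
  | const z => rfl
  | gate j => simp [Operand.subst, Operand.eval, hq]

theorem Circuit.eval_snoc_castSucc {ι : Type u} {s : ℕ} (P : Circuit ι s) (o : ArithOp)
    (a b : Operand ι s) (x : ι → ℂ) (j : Fin s) :
    (Circuit.snoc P o a b).eval x j.castSucc = P.eval x j :=
  Fin.snoc_castSucc (α := fun _ => ℂ) _ _ _

theorem Circuit.eval_snoc_last {ι : Type u} {s : ℕ} (P : Circuit ι s) (o : ArithOp)
    (a b : Operand ι s) (x : ι → ℂ) :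
    (Circuit.snoc P o a b).eval x (Fin.last s) =
      o.eval (a.eval x (P.eval x)) (b.eval x (P.eval x)) :=
  Fin.snoc_last (α := fun _ => ℂ) _ _

theorem Circuit.eval_append {ι : Type u} {κ : Type v} {s : ℕ} (P : Circuit ι s)
    (sub : κ → Operand ι s) (x : ι → ℂ) {t : ℕ} (Q : Circuit κ t) :
    (∀ j, (P.append sub Q).eval x (Fin.castAdd t j) = P.eval x j) ∧
    (∀ j, (P.append sub Q).eval x (Fin.natAdd s j) =
      Q.eval (fun k => (sub k).eval x (P.eval x)) j) := by
  induction Q with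
  | nil => exact ⟨fun j => rfl, fun j => j.elim0⟩
  | @snoc t Q o a b ih =>
    obtain ⟨h1, h2⟩ := ih
    refine ⟨fun j => ?_, fun j => Fin.lastCases ?_ (fun j => ?_) j⟩
    · exact (Circuit.eval_snoc_castSucc _ _ _ _ _ _).trans (h1 j)
    · refine (Circuit.eval_snoc_last _ _ _ _ _).trans ?_
      rw [Circuit.eval_snoc_last, Operand.eval_subst sub x _ _ _ h1 h2 a,
        Operand.eval_subst sub x _ _ _ h1 h2 b]
    · rw [Circuit.eval_snoc_castSucc]
      exact (Circuit.eval_snoc_castSucc _ _ _ _ _ _).trans (h2 j)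

/-- The map `f` can be computed by a circuit with at most `c` operations. -/
def HasCost {ι : Type u} {κ : Type v} (f : (ι → ℂ) → κ → ℂ) (c : ℝ) : Prop :=
  ∃ (s : ℕ) (P : Circuit ι s), P.Computes f ∧ (s : ℝ) ≤ c

/-- A function of the inputs that is available without any operation: one of the inputs, or a
constant. -/
def IsInputOrConst {ι : Type u} (e : (ι → ℂ) → ℂ) : Prop :=
  (∃ i, ∀ x, e x = x i) ∨ (∃ z, ∀ x, e x = z)

namespace IsInputOrConst

theorem input {ι : Type u} (i : ι) : IsInputOrConst fun x : ι → ℂ => x i := .inl ⟨i, fun _ => rfl⟩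

theorem const {ι : Type u} (z : ℂ) : IsInputOrConst fun _ : ι → ℂ => z := .inr ⟨z, fun _ => rfl⟩

end IsInputOrConst

namespace HasCost

variable {ι : Type u} {κ : Type v} {μ : Type w}

theorem mono {f : (ι → ℂ) → κ → ℂ} {c d : ℝ} (h : HasCost f c) (hcd : c ≤ d) : HasCost f d := by
  obtain ⟨s, P, hP, hs⟩ := h
  exact ⟨s, P, hP, hs.trans hcd⟩

theorem nonneg {f : (ι → ℂ) → κ → ℂ} {c : ℝ} (h : HasCost f c) : 0 ≤ c := by
  obtain ⟨s, P, hP, hs⟩ := h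
  exact (Nat.cast_nonneg s).trans hs

theorem congr {f g : (ι → ℂ) → κ → ℂ} {c : ℝ} (h : HasCost f c) (hfg : ∀ x k, f x k = g x k) :
    HasCost g c := by
  have : f = g := by funext x k; exact hfg x k
  exact this ▸ h

/-- Reading off only some outputs, possibly several times, is free. -/
theorem outputs {f : (ι → ℂ) → κ → ℂ} {c : ℝ} (h : HasCost f c) (e : μ → κ) :
    HasCost (fun x m => f x (e m)) c := by
  obtain ⟨s, P, ⟨out, hP⟩, hs⟩ := h
  exact ⟨s, P, ⟨fun m => out (e m), fun x m => hP x (e m)⟩, hs⟩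

theorem free {f : (ι → ℂ) → κ → ℂ} (h : ∀ k, IsInputOrConst fun x => f x k) : HasCost f 0 := by
  have : ∀ k, ∃ o : Operand ι 0, ∀ x v, o.eval x v = f x k := by
    intro k
    rcases h k with ⟨i, hi⟩ | ⟨z, hz⟩
    · exact ⟨.input i, fun x v => (hi x).symm⟩
    · exact ⟨.const z, fun x v => (hz x).symm⟩
  choose out hout using this
  exact ⟨0, .nil, ⟨out, fun x k => hout k x _⟩, by simp⟩

theorem comp {f : (ι → ℂ) → κ → ℂ} {g : (κ → ℂ) → μ → ℂ} {a b : ℝ}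
    (hg : HasCost g b) (hf : HasCost f a) : HasCost (fun x => g (f x)) (a + b) := by
  obtain ⟨s, P, ⟨out, hP⟩, hs⟩ := hf
  obtain ⟨t, Q, ⟨out', hQ⟩, ht⟩ := hg
  refine ⟨s + t, P.append out Q, ⟨fun m => (out' m).subst out, fun x m => ?_⟩, by
    push_cast; linarith⟩
  obtain ⟨h1, h2⟩ := P.eval_append out x Q
  rw [Operand.eval_subst out x _ _ _ h1 h2]
  have : (fun k => (out k).eval x (P.eval x)) = f x := by funext k; exact hP x k
  rw [this, hQ]

theorem comp_free {f : (ι → ℂ) → κ → ℂ} {g : (κ → ℂ) → μ → ℂ} {b : ℝ}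
    (hg : HasCost g b) (h : ∀ k, IsInputOrConst fun x => f x k) : HasCost (fun x => g (f x)) b := by
  simpa using hg.comp (free h)

theorem sumElim {f : (ι → ℂ) → κ → ℂ} {g : (ι → ℂ) → μ → ℂ} {a b : ℝ}
    (hf : HasCost f a) (hg : HasCost g b) :
    HasCost (fun x => Sum.elim (f x) (g x)) (a + b) := by
  obtain ⟨s, P, ⟨out, hP⟩, hs⟩ := hf
  obtain ⟨t, Q, ⟨out', hQ⟩, ht⟩ := hg
  refine ⟨s + t, P.append (fun i => .input i) Q,
    ⟨Sum.elim (fun k => (Operand.input k : Operand κ t).subst out)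
      (fun m => (out' m).subst (fun i => .input i)), fun x k => ?_⟩, by push_cast; linarith⟩
  obtain ⟨h1, h2⟩ := P.eval_append (fun i => .input i) x Q
  rcases k with k | m
  · exact (Operand.eval_subst out x _ _ _ h1 h2 (.input k)).trans (hP x k)
  · exact (Operand.eval_subst (fun i => .input i) x _ _ _ h1 h2 (out' m)).trans (hQ x m)

/-- The cost of computing all coordinates is at most the sum of the costs of the classes of a
partition of the coordinates. -/
theorem of_partition {I : Type*} [Fintype I] {f : (ι → ℂ) → κ → ℂ} (p : κ → I) (c : I → ℝ)
    (h : ∀ i, HasCost (fun x (k : {k // p k = i}) => f x k) (c i)) : HasCost f (∑ i, c i) := by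
  classical
  have key : ∀ s : Finset I, HasCost (fun x (k : {k // p k ∈ s}) => f x k) (∑ i ∈ s, c i) := by
    intro s
    induction s using Finset.induction_on with
    | empty => exact free fun k => absurd k.2 (Finset.notMem_empty _)
    | insert a s ha ih =>
      rw [Finset.sum_insert ha]
      refine (((h a).sumElim ih).outputs fun k : {k // p k ∈ insert a s} =>
        if hk : p k = a then .inl ⟨k, hk⟩
        else .inr ⟨k, (Finset.mem_insert.mp k.2).resolve_left hk⟩).congr fun x k => ?_
      split_ifs <;> rfl
  exact (key Finset.univ).outputs fun k => ⟨k, Finset.mem_univ _⟩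

theorem sigma {I : Type*} [Fintype I] {κ : I → Type v} {f : (ι → ℂ) → (Σ i, κ i) → ℂ} (c : I → ℝ)
    (h : ∀ i, HasCost (fun x k => f x ⟨i, k⟩) (c i)) : HasCost f (∑ i, c i) := by
  refine of_partition Sigma.fst c fun i => ?_
  refine ((h i).outputs fun k : {k : Σ i, κ i // k.1 = i} => k.2 ▸ k.1.2).congr ?_
  rintro x ⟨⟨j, k⟩, rfl⟩
  rfl

theorem add {f g : (ι → ℂ) → κ → ℂ} {a b : ℝ} [Fintype κ] (hf : HasCost f a) (hg : HasCost g b) :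
    HasCost (fun x k => f x k + g x k) (a + b + Fintype.card κ) := by
  have h1 : HasCost (fun (y : κ ⊕ κ → ℂ) k => y (.inl k) + y (.inr k)) (Fintype.card κ) := by
    have := of_partition (f := fun (y : κ ⊕ κ → ℂ) k => y (.inl k) + y (.inr k)) id
      (fun _ => (1 : ℝ)) fun i => by
        refine ⟨1, .snoc .nil .add (.input (.inl i)) (.input (.inr i)),
          ⟨fun _ => .gate (Fin.last 0), fun x k => ?_⟩, by simp⟩
        obtain ⟨k, rfl⟩ := k
        exact Circuit.eval_snoc_last _ _ _ _ _
    simpa using this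
  exact h1.comp (hf.sumElim hg)

theorem sum {I : Type*} (s : Finset I) [Fintype κ] {f : I → (ι → ℂ) → κ → ℂ} {c : I → ℝ}
    (h : ∀ i, HasCost (f i) (c i)) :
    HasCost (fun x k => ∑ i ∈ s, f i x k) (∑ i ∈ s, (c i + Fintype.card κ)) := by
  classical
  induction s using Finset.induction_on with
  | empty => exact (free fun k => .const 0).congr fun x k => by simp
  | insert a s ha ih =>
    rw [Finset.sum_insert ha]
    refine (((h a).add ih).congr fun x k => ?_).mono (by linarith)
    rw [Finset.sum_insert ha]

end HasCost

/-! ### Rectangular matrix products -/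

/-- Square matrices of every size `n` can be multiplied with `b * n ^ τ` operations. -/
def MatMulBound (b τ : ℝ) : Prop := ∀ n : ℕ, HasCost (matMulMap n) (b * (n : ℝ) ^ τ)

namespace MatMulBound

variable {b τ : ℝ}

theorem nonneg (hM : MatMulBound b τ) : 0 ≤ b := by
  simpa using (hM 1).nonneg

/-- A product of two matrices none of whose sizes exceeds the inner one, by padding to square
matrices. -/
theorem product_le_card (hM : MatMulBound b τ) {ι α β δ : Type*} [Fintype α] [Fintype β]
    [Fintype δ] (hα : Fintype.card α ≤ Fintype.card δ) (hβ : Fintype.card β ≤ Fintype.card δ)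
    {P : α → δ → (ι → ℂ) → ℂ} {Q : δ → β → (ι → ℂ) → ℂ}
    (hP : ∀ i k, IsInputOrConst (P i k)) (hQ : ∀ k j, IsInputOrConst (Q k j)) :
    HasCost (fun x (p : α × β) => ∑ k, P p.1 k x * Q k p.2 x)
      (b * (Fintype.card δ : ℝ) ^ τ) := by
  classical
  set d := Fintype.card δ
  let e : δ ≃ Fin d := Fintype.equivFin δ
  obtain ⟨eα⟩ : Nonempty (α ↪ Fin d) :=
    Function.Embedding.nonempty_of_card_le (by simpa using hα)
  obtain ⟨eβ⟩ : Nonempty (β ↪ Fin d) :=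
    Function.Embedding.nonempty_of_card_le (by simpa using hβ)
  let X : (ι → ℂ) → (Fin d × Fin d) ⊕ (Fin d × Fin d) → ℂ := fun x => Sum.elim
    (fun p => if h : ∃ i, eα i = p.1 then P h.choose (e.symm p.2) x else 0)
    (fun p => if h : ∃ j, eβ j = p.2 then Q (e.symm p.1) h.choose x else 0)
  have hX : ∀ k, IsInputOrConst fun x => X x k := by
    rintro (p | p)
    · by_cases h : ∃ i, eα i = p.1
      · simpa [X, h] using hP _ _
      · simpa [X, h] using IsInputOrConst.const 0
    · by_cases h : ∃ i, eβ i = p.2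
      · simpa [X, h] using hQ _ _
      · simpa [X, h] using IsInputOrConst.const 0
  refine (((hM d).comp_free hX).outputs fun p : α × β => (eα p.1, eβ p.2)).congr fun x p => ?_
  simp only [matMulMap, Matrix.mul_apply, Matrix.of_apply]
  refine (Fintype.sum_equiv e _ _ fun k => ?_).symm
  have h1 : ∃ i, eα i = eα p.1 := ⟨_, rfl⟩
  have h2 : ∃ i, eβ i = eβ p.2 := ⟨_, rfl⟩
  have e1 : h1.choose = p.1 := eα.injective h1.choose_spec
  have e2 : h2.choose = p.2 := eβ.injective h2.choose_spec
  simp only [X, Sum.elim_inl, Sum.elim_inr, dif_pos h1, dif_pos h2, e1, e2, e.symm_apply_apply]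

end MatMulBound

/-- A finite type splits into `card α / d + 1` classes with at most `d` elements each. -/
theorem exists_partition_card_le (α : Type*) [Fintype α] {d : ℕ} (hd : 0 < d) :
    ∃ p : α → Fin (Fintype.card α / d + 1), ∀ i, Nat.card {a // p a = i} ≤ d := by
  let e := Fintype.equivFin α
  refine ⟨fun a => ⟨e a / d, Nat.lt_succ_of_le (Nat.div_le_div_right (e a).2.le)⟩, fun i => ?_⟩
  refine (Nat.card_le_card_of_injective (β := Fin d)
    (fun a => ⟨e a.1 % d, Nat.mod_lt _ hd⟩) ?_).trans (Nat.card_fin d).le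
  rintro ⟨a, ha⟩ ⟨a', ha'⟩ h
  simp only [Fin.ext_iff] at ha ha' h
  apply Subtype.ext
  apply e.injective
  apply Fin.ext
  rw [← Nat.div_add_mod (e a) d, ← Nat.div_add_mod (e a') d, ha, ha', h]

namespace MatMulBound

variable {b τ : ℝ}

/-- A product of an arbitrarily tall matrix with a matrix that has at least as many rows as
columns: cut the tall factor into square blocks. -/
theorem product_tall (hM : MatMulBound b τ) {ι α β δ : Type*} [Fintype α] [Fintype β]
    [Fintype δ] (hβ : Fintype.card β ≤ Fintype.card δ)
    {P : α → δ → (ι → ℂ) → ℂ} {Q : δ → β → (ι → ℂ) → ℂ}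
    (hP : ∀ i k, IsInputOrConst (P i k)) (hQ : ∀ k j, IsInputOrConst (Q k j)) :
    HasCost (fun x (p : α × β) => ∑ k, P p.1 k x * Q k p.2 x)
      (b * (Fintype.card α * Fintype.card δ + (Fintype.card δ : ℝ) ^ 2)
        * (Fintype.card δ : ℝ) ^ (τ - 2)) := by
  classical
  have hb := hM.nonneg
  rcases Nat.eq_zero_or_pos (Fintype.card δ) with hd | hd
  · have := Fintype.card_eq_zero_iff.mp hd
    refine ((HasCost.free fun k => .const 0).congr fun x p => ?_).mono (by positivity)
    simp
  obtain ⟨p, hp⟩ := exists_partition_card_le α hd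
  refine (HasCost.of_partition (fun k : α × β => p k.1)
    (fun _ => b * (Fintype.card δ : ℝ) ^ τ) fun i => ?_).mono ?_
  · have := hM.product_le_card (α := {a // p a = i}) (by
      rw [← Nat.card_eq_fintype_card]; exact hp i) hβ
      (P := fun i k => P i k) (fun i k => hP i k) hQ
    exact this.outputs fun k : {k : α × β // p k.1 = i} => (⟨k.1.1, k.2⟩, k.1.2)
  · have hd' : (0 : ℝ) < Fintype.card δ := by exact_mod_cast hd
    have h1 : (Fintype.card δ : ℝ) ^ τ = (Fintype.card δ : ℝ) ^ (τ - 2) * Fintype.card δ ^ 2 := by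
      rw [← Real.rpow_natCast, ← Real.rpow_add hd']; norm_num
    have h2 : ((Fintype.card α / Fintype.card δ : ℕ) : ℝ) * Fintype.card δ ≤ Fintype.card α := by
      exact_mod_cast Nat.div_mul_le_self _ _
    simp only [Finset.sum_const, Finset.card_univ, Fintype.card_fin, nsmul_eq_mul]
    push_cast
    calc (((Fintype.card α / Fintype.card δ : ℕ) : ℝ) + 1) * (b * (Fintype.card δ : ℝ) ^ τ)
        = (b * (Fintype.card δ : ℝ) ^ (τ - 2)) * ((((Fintype.card α / Fintype.card δ : ℕ) : ℝ) *
            Fintype.card δ) * Fintype.card δ + Fintype.card δ ^ 2) := by rw [h1]; ring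
      _ ≤ (b * (Fintype.card δ : ℝ) ^ (τ - 2)) *
          (Fintype.card α * Fintype.card δ + Fintype.card δ ^ 2) := by gcongr
      _ = _ := by ring

/-- A product of a matrix that has at least as many columns as rows with an arbitrarily wide
matrix. -/
theorem product_wide (hM : MatMulBound b τ) {ι α β δ : Type*} [Fintype α] [Fintype β]
    [Fintype δ] (hα : Fintype.card α ≤ Fintype.card δ)
    {P : α → δ → (ι → ℂ) → ℂ} {Q : δ → β → (ι → ℂ) → ℂ}
    (hP : ∀ i k, IsInputOrConst (P i k)) (hQ : ∀ k j, IsInputOrConst (Q k j)) :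
    HasCost (fun x (p : α × β) => ∑ k, P p.1 k x * Q k p.2 x)
      (b * (Fintype.card β * Fintype.card δ + (Fintype.card δ : ℝ) ^ 2)
        * (Fintype.card δ : ℝ) ^ (τ - 2)) :=
  ((hM.product_tall hα (P := fun j k => Q k j) (Q := fun k i => P i k) (fun j k => hQ k j)
    (fun k i => hP i k)).outputs Prod.swap).congr fun x p => by simp [mul_comm]

end MatMulBound

/-! ### The exponent of matrix multiplication is at least two -/

theorem Operand.eval_eq_gate_of_not_isInputOrConst {ι : Type u} {s : ℕ} (P : Circuit ι s)
    (o : Operand ι s) (h : ¬ IsInputOrConst fun x => o.eval x (P.eval x)) :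
    ∃ j, o = .gate j := by
  cases o with
  | input i => exact absurd (.input i) h
  | const z => exact absurd (.const z) h
  | gate j => exact ⟨j, rfl⟩

/-- The `n ^ 2` entries of a product of two variable matrices are distinct functions, none of
which is an input or a constant, so each needs a gate of its own. -/
theorem sq_le_of_computes_matMulMap {n s : ℕ}
    (P : Circuit ((Fin n × Fin n) ⊕ (Fin n × Fin n)) s) (h : P.Computes (matMulMap n)) :
    n ^ 2 ≤ s := by
  classical
  obtain ⟨out, hout⟩ := h
  -- the left factor is the matrix unit at `p`, scaled by `z`, and the right one is scalar
  let X : ℂ → ℂ → Fin n × Fin n → (Fin n × Fin n) ⊕ (Fin n × Fin n) → ℂ := fun z w p =>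
    Sum.elim (fun q => if q = p then z else 0) (fun q => if q.1 = q.2 then w else 0)
  have hX : ∀ z w p q, matMulMap n (X z w p) q = if q = p then z * w else 0 := by
    intro z w p q
    simp [matMulMap, Matrix.mul_apply, X]
  have hgate : ∀ p, ∃ j, out p = .gate j := by
    intro p
    apply Operand.eval_eq_gate_of_not_isInputOrConst P
    simp only [hout]
    rintro (⟨i | i, hi⟩ | ⟨z, hz⟩)
    · have h1 := hi (X 1 2 p)
      simp only [hX, if_true] at h1
      simp only [X, Sum.elim_inl] at h1
      split_ifs at h1 <;> norm_num at h1
    · have h1 := hi (X 2 1 p)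
      simp only [hX, if_true] at h1
      simp only [X, Sum.elim_inr] at h1
      split_ifs at h1 <;> norm_num at h1
    · have h1 := hz (X 1 1 p)
      have h2 := hz (X 2 1 p)
      simp only [hX, if_true] at h1 h2
      rw [← h1] at h2
      norm_num at h2
  choose g hg using hgate
  have hinj : Function.Injective g := by
    intro p q hpq
    by_contra hne
    have h1 := hout (X 1 1 p) p
    have h2 := hout (X 1 1 p) q
    rw [hX] at h1 h2
    rw [hg, hpq, ← hg, h2, if_neg (Ne.symm hne), if_pos rfl] at h1
    norm_num at h1
  have := Fintype.card_le_of_injective g hinj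
  simpa [sq] using this

theorem MatMulBound.two_le {b τ : ℝ} (hM : MatMulBound b τ) : 2 ≤ τ := by
  by_contra! hτ
  have hlim : Filter.Tendsto (fun n : ℕ => (n : ℝ) ^ (2 - τ)) Filter.atTop Filter.atTop :=
    (tendsto_rpow_atTop (by linarith)).comp tendsto_natCast_atTop_atTop
  obtain ⟨n, hn, hn1⟩ :=
    ((hlim.eventually_gt_atTop b).and (Filter.eventually_ge_atTop 1)).exists
  obtain ⟨s, P, hP, hs⟩ := hM n
  have h1 : ((n : ℝ)) ^ 2 ≤ b * (n : ℝ) ^ τ := by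
    refine le_trans ?_ hs
    exact_mod_cast sq_le_of_computes_matMulMap P hP
  have hn0 : (0 : ℝ) < n := by exact_mod_cast hn1
  have h2 : (n : ℝ) ^ 2 = (n : ℝ) ^ (2 - τ) * (n : ℝ) ^ τ := by
    rw [← Real.rpow_add hn0, ← Real.rpow_natCast]; norm_num
  rw [h2] at h1
  exact absurd (le_of_mul_le_mul_right h1 (Real.rpow_pos_of_pos hn0 τ)) (not_le.mpr hn)

/-- The schoolbook algorithm. -/
theorem matMulBound_three : MatMulBound 2 3 := by
  intro n
  have hmul : HasCost (fun (x : (Fin n × Fin n) ⊕ (Fin n × Fin n) → ℂ)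
      (t : (Fin n × Fin n) × Fin n) => x (.inl (t.1.1, t.2)) * x (.inr (t.2, t.1.2)))
      ((n : ℝ) ^ 3) := by
    have := HasCost.of_partition (f := fun (x : (Fin n × Fin n) ⊕ (Fin n × Fin n) → ℂ)
      (t : (Fin n × Fin n) × Fin n) => x (.inl (t.1.1, t.2)) * x (.inr (t.2, t.1.2))) id
      (fun _ => (1 : ℝ)) fun i => by
        refine ⟨1, .snoc .nil .mul (.input (.inl (i.1.1, i.2))) (.input (.inr (i.2, i.1.2))),
          ⟨fun _ => .gate (Fin.last 0), fun x k => ?_⟩, by simp⟩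
        obtain ⟨k, rfl⟩ := k
        exact Circuit.eval_snoc_last _ _ _ _ _
    refine this.mono (le_of_eq ?_)
    simp
    ring
  have hsum : HasCost (fun (y : (Fin n × Fin n) × Fin n → ℂ) p => ∑ k, y (p, k)) ((n : ℝ) ^ 3) := by
    refine (HasCost.sum Finset.univ (c := fun _ => 0)
      (f := fun k (y : (Fin n × Fin n) × Fin n → ℂ) p => y (p, k))
      fun k => .free fun p => .input (p, k)).mono (le_of_eq ?_)
    simp
    ring
  refine ((hsum.comp hmul).congr fun x p => ?_).mono (le_of_eq ?_)
  · simp [matMulMap, Matrix.mul_apply]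
  · rw [show (3 : ℝ) = ((3 : ℕ) : ℝ) by norm_num, Real.rpow_natCast]
    ring

/-- Exponents arbitrarily close to `ω` are realized by matrix multiplication circuits. -/
theorem exists_matMulBound {ε : ℝ} (hε : 0 < ε) :
    ∃ b τ, MatMulBound b τ ∧ τ < matMulExponent + ε := by
  obtain ⟨τ, ⟨b, hb⟩, hτ⟩ := exists_lt_of_csInf_lt
    (s := {τ : ℝ | ∃ b : ℝ, ∀ n : ℕ, ∃ (s : ℕ) (P : Circuit ((Fin n × Fin n) ⊕ (Fin n × Fin n)) s),
    P.Computes (matMulMap n) ∧ (s : ℝ) ≤ b * (n : ℝ) ^ τ}) ⟨3, 2, matMulBound_three⟩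
    (lt_add_of_pos_right matMulExponent hε)
  exact ⟨b, τ, hb, hτ⟩

/-! ### Schur orthogonality and complete sets of irreducible representations -/

section Schur

open Matrix Representation

variable {G : Type*} [Group G]

/-- A matrix that intertwines two matrix representations, as an intertwining map. -/
noncomputable def intertwiningOfMatrix {d e : ℕ} (ρ : G →* Matrix (Fin d) (Fin d) ℂ)
    (σ : G →* Matrix (Fin e) (Fin e) ℂ) (T : Matrix (Fin d) (Fin e) ℂ)
    (hT : ∀ g, ρ g * T = T * σ g) : IntertwiningMap (matrixRep σ) (matrixRep ρ) where
  toLinearMap := T.mulVecLin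
  isIntertwining' g := by
    refine LinearMap.ext fun v => ?_
    change T *ᵥ (σ g *ᵥ v) = ρ g *ᵥ (T *ᵥ v)
    rw [Matrix.mulVec_mulVec, Matrix.mulVec_mulVec, hT]

theorem Representation.IsIrreducible.of_equiv {V W : Type*} [AddCommGroup V] [Module ℂ V]
    [AddCommGroup W] [Module ℂ W] {ρ : Representation ℂ G V} {σ : Representation ℂ G W}
    (e : ρ.Equiv σ) (h : σ.IsIrreducible) : ρ.IsIrreducible := by
  rw [irreducible_iff_isSimpleModule_asModule] at h ⊢
  let f := IntertwiningMap.equivLinearMapAsModule ρ σ e.toIntertwiningMap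
  have hf : Function.Bijective f := e.toLinearEquiv.bijective
  exact IsSimpleModule.congr (LinearEquiv.ofBijective f hf)

theorem dim_pos_of_isIrreducible {d : ℕ} {ρ : G →* Matrix (Fin d) (Fin d) ℂ}
    (h : (matrixRep ρ).IsIrreducible) : 0 < d := by
  rcases Nat.eq_zero_or_pos d with rfl | hd
  · have h1 : (⊥ : Subrepresentation (matrixRep ρ)) = ⊤ := by
      apply Subrepresentation.toSubmodule_injective
      exact Subsingleton.elim _ _
    exact absurd h1 bot_ne_top
  · exact hd

variable [Fintype G]

theorem sum_mul_mul_inv_intertwines {d e : ℕ} (ρ : G →* Matrix (Fin d) (Fin d) ℂ)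
    (σ : G →* Matrix (Fin e) (Fin e) ℂ) (E : Matrix (Fin d) (Fin e) ℂ) (h : G) :
    ρ h * ∑ g, ρ g * E * σ g⁻¹ = (∑ g, ρ g * E * σ g⁻¹) * σ h := by
  rw [Matrix.mul_sum, Matrix.sum_mul]
  refine Fintype.sum_equiv (Equiv.mulLeft h) _ _ fun g => ?_
  have h1 : σ (h * g)⁻¹ * σ h = σ g⁻¹ := by rw [← map_mul]; congr 1; group
  simp only [Equiv.coe_mulLeft, map_mul ρ, Matrix.mul_assoc, h1]

/-- Schur's lemma, averaged: there is no intertwiner between inequivalent irreducibles. -/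
theorem schur_of_isEmpty {d e : ℕ} {ρ : G →* Matrix (Fin d) (Fin d) ℂ}
    {σ : G →* Matrix (Fin e) (Fin e) ℂ} (hρ : (matrixRep ρ).IsIrreducible)
    (hσ : (matrixRep σ).IsIrreducible) (hne : IsEmpty ((matrixRep σ).Equiv (matrixRep ρ)))
    (E : Matrix (Fin d) (Fin e) ℂ) : ∑ g, ρ g * E * σ g⁻¹ = 0 := by
  have h1 : intertwiningOfMatrix ρ σ _ (sum_mul_mul_inv_intertwines ρ σ E) = 0 :=
    Subsingleton.elim _ _
  have h2 := congrArg IntertwiningMap.toLinearMap h1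
  refine Matrix.ext_of_mulVec_single fun i => ?_
  rw [Matrix.zero_mulVec]
  exact LinearMap.congr_fun h2 (Pi.single i 1)

/-- Schur's lemma, averaged: self-intertwiners are scalar, and the trace determines the scalar. -/
theorem schur_self {d : ℕ} {ρ : G →* Matrix (Fin d) (Fin d) ℂ}
    (hρ : (matrixRep ρ).IsIrreducible) (E : Matrix (Fin d) (Fin d) ℂ) :
    (d : ℂ) • ∑ g, ρ g * E * ρ g⁻¹ = ((Fintype.card G : ℂ) * E.trace) • 1 := by
  set T := ∑ g, ρ g * E * ρ g⁻¹ with hT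
  have hf := sum_mul_mul_inv_intertwines ρ ρ E
  rw [← hT] at hf
  obtain ⟨c, hc⟩ := (IsIrreducible.algebraMap_intertwiningMap_bijective_of_isAlgClosed
    (ρ := matrixRep ρ)).2 (intertwiningOfMatrix ρ ρ T hf)
  have h3 : T = c • 1 := by
    have h2 := congrArg IntertwiningMap.toLinearMap hc
    refine Matrix.ext_of_mulVec_single fun i => ?_
    refine (LinearMap.congr_fun h2 (Pi.single i 1)).symm.trans ?_
    rw [Matrix.smul_mulVec, Matrix.one_mulVec]
    rfl
  have htr : T.trace = Fintype.card G * E.trace := by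
    rw [hT, Matrix.trace_sum]
    have : ∀ g, (ρ g * E * ρ g⁻¹).trace = E.trace := by
      intro g
      rw [Matrix.trace_mul_comm, ← Matrix.mul_assoc, ← map_mul, inv_mul_cancel, map_one,
        Matrix.one_mul]
    simp [this]
  rw [← htr, h3, Matrix.trace_smul, Matrix.trace_one, smul_smul]
  simp [mul_comm]

/-- Pairwise inequivalent irreducible matrix representations, indexed by `I`. Unlike in
`CompleteIrreps`, other irreducible representations may be missing. -/
structure IrrepFamily (G : Type*) [Group G] (I : Type*) where
  /-- the degrees -/
  dim : I → ℕ
  /-- the representations -/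
  rep : (i : I) → G →* Matrix (Fin (dim i)) (Fin (dim i)) ℂ
  irreducible : ∀ i, (matrixRep (rep i)).IsIrreducible
  inequivalent : ∀ i j, i ≠ j → IsEmpty ((matrixRep (rep i)).Equiv (matrixRep (rep j)))

theorem mul_single_mul_apply {d e : ℕ} (A : Matrix (Fin d) (Fin d) ℂ) (B : Matrix (Fin e) (Fin e) ℂ)
    (a b : Fin d) (c f : Fin e) :
    (A * Matrix.single b c (1 : ℂ) * B) a f = A a b * B c f := by
  simp [Matrix.mul_apply, Matrix.single_apply, Finset.sum_ite_eq, ite_and]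

/-- Schur orthogonality: the matrix coefficients of pairwise inequivalent irreducible
representations are linearly independent functions on the group. -/
theorem IrrepFamily.linearIndependent {I : Type*} [Fintype I] (R : IrrepFamily G I) :
    LinearIndependent ℂ fun (z : Σ i, Fin (R.dim i) × Fin (R.dim i)) (g : G) =>
      R.rep z.1 g z.2.1 z.2.2 := by
  classical
  rw [Fintype.linearIndependent_iff]
  rintro l hl ⟨j, a, b⟩
  -- pair the relation with the dual matrix coefficient `g ↦ ρ_j(g⁻¹) b a`
  have h1 : ∑ g, (∑ z, l z * R.rep z.1 g z.2.1 z.2.2) * R.rep j g⁻¹ b a = 0 := by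
    refine Finset.sum_eq_zero fun g _ => ?_
    have := congrFun hl g
    simp only [Finset.sum_apply, Pi.smul_apply, smul_eq_mul, Pi.zero_apply] at this
    rw [this, zero_mul]
  have h2 : ∀ i (p q : Fin (R.dim i)), ∑ g, R.rep i g p q * R.rep j g⁻¹ b a =
      (∑ g, R.rep i g * Matrix.single q b (1 : ℂ) * R.rep j g⁻¹) p a := by
    intro i p q
    rw [Matrix.sum_apply]
    simp only [mul_single_mul_apply]
  have h3 : ∀ z : (Σ i, Fin (R.dim i) × Fin (R.dim i)),
      (R.dim j : ℂ) * ∑ g, R.rep z.1 g z.2.1 z.2.2 * R.rep j g⁻¹ b a =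
        if z = ⟨j, a, b⟩ then (Fintype.card G : ℂ) else 0 := by
    rintro ⟨i, p, q⟩
    rw [h2]
    by_cases hij : i = j
    · subst hij
      have := congrFun (congrFun (schur_self (R.irreducible i) (Matrix.single q b (1 : ℂ))) p) a
      simp only [Matrix.smul_apply, smul_eq_mul] at this
      rw [this]
      by_cases hqb : q = b
      · subst hqb
        by_cases hpa : p = a
        · subst hpa; simp
        · simp [hpa]
      · simp [hqb]
    · rw [schur_of_isEmpty (R.irreducible i) (R.irreducible j) (R.inequivalent j i (Ne.symm hij))]
      have : (⟨i, p, q⟩ : Σ i, Fin (R.dim i) × Fin (R.dim i)) ≠ ⟨j, a, b⟩ := fun h =>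
        hij (congrArg Sigma.fst h)
      simp [this]
  have h4 : (R.dim j : ℂ) * ∑ g, (∑ z, l z * R.rep z.1 g z.2.1 z.2.2) * R.rep j g⁻¹ b a =
      l ⟨j, a, b⟩ * Fintype.card G := by
    simp only [Finset.sum_mul]
    rw [Finset.sum_comm]
    simp only [mul_assoc, ← Finset.mul_sum]
    rw [Finset.mul_sum]
    simp only [mul_left_comm _ (l _), h3]
    simp
  rw [h1, mul_zero] at h4
  have hG : (Fintype.card G : ℂ) ≠ 0 := by simp
  exact (mul_eq_zero.mp h4.symm).resolve_right hG

theorem IrrepFamily.card_le {I : Type*} [Fintype I] (R : IrrepFamily G I) :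
    Fintype.card (Σ i, Fin (R.dim i) × Fin (R.dim i)) ≤ Fintype.card G := by
  simpa using R.linearIndependent.fintype_card_le_finrank

theorem IrrepFamily.card_index_le {I : Type*} [Fintype I] (R : IrrepFamily G I) :
    Fintype.card I ≤ Fintype.card G := by
  refine le_trans (Fintype.card_le_of_injective (fun i => (⟨i,
    ⟨0, dim_pos_of_isIrreducible (R.irreducible i)⟩,
    ⟨0, dim_pos_of_isIrreducible (R.irreducible i)⟩⟩ : Σ i, Fin (R.dim i) × Fin (R.dim i)))
    fun i j h => congrArg Sigma.fst h) R.card_le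

/-- A largest family of pairwise inequivalent irreducible representations is complete. -/
theorem nonempty_completeIrreps : Nonempty (CompleteIrreps G) := by
  classical
  let S : Set ℕ := {n | Nonempty (IrrepFamily G (Fin n))}
  have hbdd : BddAbove S := ⟨Fintype.card G, by
    rintro n ⟨R⟩
    simpa using R.card_index_le⟩
  have hS0 : S.Nonempty := ⟨0, ⟨⟨fun i => i.elim0, fun i => i.elim0, fun i => i.elim0,
    fun i => i.elim0⟩⟩⟩
  obtain ⟨R⟩ : sSup S ∈ S := Nat.sSup_mem hS0 hbdd
  refine ⟨⟨sSup S, R.dim, R.rep, R.irreducible, R.inequivalent, fun d ρ hρ => ?_⟩⟩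
  by_contra! hne
  have hmem : sSup S + 1 ∈ S := by
    refine ⟨⟨Fin.cons d R.dim, Fin.cons (α := fun i => G →* Matrix
      (Fin ((Fin.cons d R.dim : Fin (sSup S + 1) → ℕ) i))
      (Fin ((Fin.cons d R.dim : Fin (sSup S + 1) → ℕ) i)) ℂ) ρ R.rep, fun i => ?_, fun i j => ?_⟩⟩
    · refine Fin.cases ?_ (fun i => ?_) i
      · exact hρ
      · exact R.irreducible i
    · refine Fin.cases ?_ (fun i => ?_) i <;> refine Fin.cases ?_ (fun j => ?_) j
      · exact fun h => absurd rfl h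
      · exact fun _ => hne j
      · exact fun _ => ⟨fun e => (hne i).false e.symm⟩
      · exact fun h => R.inequivalent i j fun h' => h (congrArg Fin.succ h')
  exact absurd (le_csSup hbdd hmem) (by simp)

namespace CompleteIrreps

variable (R : CompleteIrreps G)

/-- The index type of the matrix entries of a generalized DFT. -/
abbrev Entries {G : Type*} [Group G] (R : CompleteIrreps G) : Type :=
  Σ i : Fin R.num, Fin (R.dim i) × Fin (R.dim i)

theorem card_entries_le : Fintype.card R.Entries ≤ Fintype.card G :=
  IrrepFamily.card_le ⟨R.dim, R.rep, R.irreducible, R.inequivalent⟩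

theorem sum_dim_sq_le : ∑ i, R.dim i ^ 2 ≤ Fintype.card G := by
  refine le_trans (le_of_eq ?_) R.card_entries_le
  simp [sq]

theorem dim_pos {G : Type*} [Group G] (R : CompleteIrreps G) (i : Fin R.num) : 0 < R.dim i :=
  dim_pos_of_isIrreducible (R.irreducible i)

end CompleteIrreps

end Schur

/-! ### Bases adapted to the irreducible representations -/

section Decomposition

open Matrix Representation

variable {G : Type*} [Group G]

/-- The linear isomorphism `e` identifies the representation `σ` with the direct sum of the
representations of `R`, the `i`-th one repeated once for each element of `μ i`. -/
def IsIsotypicDecomposition (R : CompleteIrreps G) {W : Type*}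
    [AddCommGroup W] [Module ℂ W] (σ : Representation ℂ G W) (μ : Fin R.num → Type)
    (e : W ≃ₗ[ℂ] ((Σ i, μ i × Fin (R.dim i)) → ℂ)) : Prop :=
  ∀ g w i p a, e (σ g w) ⟨i, p, a⟩ = ∑ a', R.rep i g a a' * e w ⟨i, p, a'⟩

/-- A representation in a finite-dimensional space, written in a basis. -/
theorem exists_equiv_matrixRep {W : Type*} [AddCommGroup W] [Module ℂ W]
    [FiniteDimensional ℂ W] (σ : Representation ℂ G W) :
    ∃ (d : ℕ) (ρ : G →* Matrix (Fin d) (Fin d) ℂ), Nonempty ((matrixRep ρ).Equiv σ) := by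
  let b := Module.finBasis ℂ W
  refine ⟨_, ((LinearMap.toMatrixAlgEquiv b : _ ≃ₐ[ℂ] _) : _ →* _).comp σ,
    ⟨Representation.Equiv.mk b.equivFun.symm fun g => ?_⟩⟩
  refine LinearMap.ext fun v => ?_
  apply b.equivFun.injective
  change b.equivFun (b.equivFun.symm ((LinearMap.toMatrix b b (σ g)) *ᵥ v)) =
    b.equivFun (σ g (b.equivFun.symm v))
  rw [LinearEquiv.apply_symm_apply]
  refine Eq.trans ?_ (LinearMap.toMatrix_mulVec_repr b b (σ g) (b.equivFun.symm v))
  congr 1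
  exact (b.equivFun.apply_symm_apply v).symm

theorem exists_isotypicDecomposition_of_irreducible (R : CompleteIrreps G) {W : Type*}
    [AddCommGroup W] [Module ℂ W] [FiniteDimensional ℂ W] {σ : Representation ℂ G W}
    (hirr : σ.IsIrreducible) :
    ∃ (μ : Fin R.num → Type) (_ : ∀ i, Finite (μ i))
      (e : W ≃ₗ[ℂ] ((Σ i, μ i × Fin (R.dim i)) → ℂ)), IsIsotypicDecomposition R σ μ e := by
  obtain ⟨d, ρ, ⟨f⟩⟩ := exists_equiv_matrixRep σ
  obtain ⟨j, ⟨f'⟩⟩ := R.complete d ρ (IsIrreducible.of_equiv f hirr)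
  let q : (Σ i, PLift (i = j) × Fin (R.dim i)) ≃ Fin (R.dim j) :=
    { toFun := fun z => z.2.1.down ▸ z.2.2
      invFun := fun a => ⟨j, ⟨rfl⟩, a⟩
      left_inv := by rintro ⟨i, ⟨rfl⟩, a⟩; rfl
      right_inv := fun a => rfl }
  refine ⟨fun i => PLift (i = j), fun i => inferInstance,
    f.toLinearEquiv.symm ≪≫ₗ f'.toLinearEquiv ≪≫ₗ LinearEquiv.funCongrLeft ℂ ℂ q, ?_⟩
  rintro g w i ⟨rfl⟩ a
  have h1 : f.toLinearEquiv.symm (σ g w) = matrixRep ρ g (f.toLinearEquiv.symm w) := by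
    rw [LinearEquiv.symm_apply_eq]
    refine Eq.trans ?_ (LinearMap.congr_fun (f.isIntertwining' g) _).symm
    exact congrArg (σ g) (f.toLinearEquiv.apply_symm_apply w).symm
  have h2 : f'.toLinearEquiv (matrixRep ρ g (f.toLinearEquiv.symm w)) =
      R.rep i g *ᵥ f'.toLinearEquiv (f.toLinearEquiv.symm w) :=
    LinearMap.congr_fun (f'.isIntertwining' g) _
  change f'.toLinearEquiv (f.toLinearEquiv.symm (σ g w)) a = _
  rw [h1, h2]
  rfl

/-- By Maschke's theorem, a proper nonzero subrepresentation has a complement, so representations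
decompose by induction on the dimension. -/
theorem exists_isotypicDecomposition [Finite G] (R : CompleteIrreps G) :
    ∀ (n : ℕ) {W : Type} [AddCommGroup W] [Module ℂ W] [FiniteDimensional ℂ W]
      (σ : Representation ℂ G W), Module.finrank ℂ W = n →
      ∃ (μ : Fin R.num → Type) (_ : ∀ i, Finite (μ i))
        (e : W ≃ₗ[ℂ] ((Σ i, μ i × Fin (R.dim i)) → ℂ)), IsIsotypicDecomposition R σ μ e := by
  intro n
  induction n using Nat.strong_induction_on with
  | _ n ih =>
  intro W _ _ _ σ hn
  by_cases hirr : σ.IsIrreducible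
  · exact exists_isotypicDecomposition_of_irreducible R hirr
  rcases subsingleton_or_nontrivial W with hW | hW
  · have : IsEmpty (Σ i : Fin R.num, Empty × Fin (R.dim i)) := ⟨fun z => z.2.1.elim⟩
    exact ⟨fun _ => Empty, fun _ => inferInstance, LinearEquiv.ofSubsingleton _ _,
      fun g w i p => p.elim⟩
  obtain ⟨P, hP0, hP1⟩ : ∃ P : Subrepresentation σ, P ≠ ⊥ ∧ P ≠ ⊤ := by
    by_contra! h
    have hne : Nontrivial (Subrepresentation σ) :=
      ⟨⊥, ⊤, fun h => bot_ne_top (congrArg Subrepresentation.toSubmodule h)⟩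
    refine hirr { eq_bot_or_eq_top := fun P => ?_ }
    · by_cases hP : P = ⊥
      · exact .inl hP
      · exact .inr (h P hP)
  have : NeZero (Nat.card G : ℂ) := ⟨by exact_mod_cast Nat.card_pos.ne'⟩
  obtain ⟨Q, hPQ⟩ := exists_isCompl P
  have hc : IsCompl P.toSubmodule Q.toSubmodule := by
    refine ⟨?_, ?_⟩
    · rw [disjoint_iff]
      exact congrArg Subrepresentation.toSubmodule hPQ.inf_eq_bot
    · rw [codisjoint_iff]
      exact congrArg Subrepresentation.toSubmodule hPQ.sup_eq_top
  have hfr := Submodule.finrank_add_eq_of_isCompl hc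
  have hP0' : P.toSubmodule ≠ ⊥ := fun h => hP0 (Subrepresentation.toSubmodule_injective h)
  have hP1' : P.toSubmodule ≠ ⊤ := fun h => hP1 (Subrepresentation.toSubmodule_injective h)
  have hlt := Submodule.finrank_lt hP1'
  have hpos := Submodule.one_le_finrank_iff.mpr hP0'
  obtain ⟨μ, hμ, eP, hP⟩ := ih _ (hn ▸ hlt) P.toRepresentation rfl
  obtain ⟨ν, hν, eQ, hQ⟩ := ih (Module.finrank ℂ Q.toSubmodule) (by omega) Q.toRepresentation rfl
  let q : (Σ i, (μ i ⊕ ν i) × Fin (R.dim i)) ≃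
      (Σ i, μ i × Fin (R.dim i)) ⊕ (Σ i, ν i × Fin (R.dim i)) :=
    { toFun := fun z => match z with
        | ⟨i, .inl p, a⟩ => .inl ⟨i, p, a⟩
        | ⟨i, .inr p, a⟩ => .inr ⟨i, p, a⟩
      invFun := Sum.elim (fun z => ⟨z.1, .inl z.2.1, z.2.2⟩) (fun z => ⟨z.1, .inr z.2.1, z.2.2⟩)
      left_inv := by rintro ⟨i, p | p, a⟩ <;> rfl
      right_inv := by rintro (⟨i, p, a⟩ | ⟨i, p, a⟩) <;> rfl }
  let E := Submodule.prodEquivOfIsCompl _ _ hc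
  refine ⟨fun i => μ i ⊕ ν i, fun i => inferInstance, E.symm ≪≫ₗ (eP.prodCongr eQ) ≪≫ₗ
    (LinearEquiv.sumArrowLequivProdArrow _ _ ℂ ℂ).symm ≪≫ₗ LinearEquiv.funCongrLeft ℂ ℂ q, ?_⟩
  intro g w i
  obtain ⟨⟨x, y⟩, rfl⟩ := E.surjective w
  have h1 : σ g (E (x, y)) = E (P.toRepresentation g x, Q.toRepresentation g y) :=
    map_add (σ g) (x : W) (y : W)
  rw [h1]
  simp only [LinearEquiv.trans_apply, E.symm_apply_apply]
  rintro (p | p) a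
  · exact hP g x i p a
  · exact hQ g y i p a

/-- The block-diagonal matrix of `g` in the direct sum of the representations of `R`, the `i`-th
one repeated once for each element of `μ i`. -/
noncomputable def CompleteIrreps.sumRep (R : CompleteIrreps G) (μ : Fin R.num → Type) (g : G) :
    Matrix (Σ i, μ i × Fin (R.dim i)) (Σ i, μ i × Fin (R.dim i)) ℂ := by
  classical
  exact Matrix.blockDiagonal' fun i => Matrix.kroneckerMap (· * ·) 1 (R.rep i g)

variable (R : CompleteIrreps G) (μ : Fin R.num → Type) [∀ i, Fintype (μ i)]

theorem CompleteIrreps.sumRep_mul_apply {κ : Type*} (g : G)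
    (X : Matrix (Σ i, μ i × Fin (R.dim i)) κ ℂ) (i : Fin R.num) (p : μ i) (a : Fin (R.dim i))
    (k : κ) : (R.sumRep μ g * X) ⟨i, p, a⟩ k = ∑ a', R.rep i g a a' * X ⟨i, p, a'⟩ k := by
  classical
  rw [Matrix.mul_apply, Fintype.sum_sigma, Finset.sum_eq_single i, Fintype.sum_prod_type,
    Finset.sum_eq_single p]
  · simp [sumRep, Matrix.blockDiagonal'_apply]
  · intro p' _ hp
    simp [sumRep, Matrix.blockDiagonal'_apply, Matrix.one_apply_ne hp.symm]
  · simp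
  · intro j _ hj
    simp [sumRep, Matrix.blockDiagonal'_apply, hj.symm]
  · simp

theorem CompleteIrreps.mul_sumRep_apply {κ : Type*} (g : G)
    (X : Matrix κ (Σ i, μ i × Fin (R.dim i)) ℂ) (i : Fin R.num) (p : μ i) (a : Fin (R.dim i))
    (k : κ) : (X * R.sumRep μ g) k ⟨i, p, a⟩ = ∑ a', X k ⟨i, p, a'⟩ * R.rep i g a' a := by
  classical
  rw [Matrix.mul_apply, Fintype.sum_sigma, Finset.sum_eq_single i, Fintype.sum_prod_type,
    Finset.sum_eq_single p]
  · simp [sumRep, Matrix.blockDiagonal'_apply]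
  · intro p' _ hp
    simp [sumRep, Matrix.blockDiagonal'_apply, Matrix.one_apply_ne hp]
  · simp
  · intro j _ hj
    simp [sumRep, Matrix.blockDiagonal'_apply, hj]
  · simp

/-- Every matrix representation of a finite group is conjugate to a block-diagonal one whose
diagonal blocks belong to a given complete set of irreducible representations. -/
theorem CompleteIrreps.exists_conj_sumRep [Finite G] {d : ℕ} (ρ : G →* Matrix (Fin d) (Fin d) ℂ) :
    ∃ (μ : Fin R.num → Type) (_ : ∀ i, Fintype (μ i))
      (S : Matrix (Fin d) (Σ i, μ i × Fin (R.dim i)) ℂ)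
      (T : Matrix (Σ i, μ i × Fin (R.dim i)) (Fin d) ℂ),
      Fintype.card (Σ i, μ i × Fin (R.dim i)) = d ∧ ∀ g, ρ g = S * R.sumRep μ g * T := by
  classical
  obtain ⟨μ, hμ, e, he⟩ := exists_isotypicDecomposition R _ (matrixRep ρ) rfl
  have := fun i => Fintype.ofFinite (μ i)
  refine ⟨μ, this, LinearMap.toMatrix' e.symm.toLinearMap, LinearMap.toMatrix' e.toLinearMap,
    ?_, fun g => ?_⟩
  · simpa using e.finrank_eq.symm
  · have h1 : e.toLinearMap ∘ₗ (matrixRep ρ g) =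
        Matrix.toLin' (R.sumRep μ g) ∘ₗ e.toLinearMap := by
      refine LinearMap.ext fun w => funext ?_
      rintro ⟨i, p, a⟩
      refine (he g w i p a).trans ?_
      have := R.sumRep_mul_apply μ g (Matrix.of fun z (_ : Unit) => e w z) i p a ()
      exact this.symm
    have h2 : LinearMap.toMatrix' (matrixRep ρ g) = ρ g := LinearMap.toMatrix'_toLin' (ρ g)
    have h3 : matrixRep ρ g = e.symm.toLinearMap ∘ₗ e.toLinearMap ∘ₗ matrixRep ρ g := by
      refine LinearMap.ext fun w => ?_
      simp
    rw [← h2, h3, h1, LinearMap.toMatrix'_comp, LinearMap.toMatrix'_comp,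
      LinearMap.toMatrix'_toLin', Matrix.mul_assoc]

end Decomposition

/-! ### Batched DFTs and the double subgroup reduction -/

namespace HasCost

/-- Every coordinate of `g` is a coordinate of `f`. -/
theorem of_forall_exists {ι κ μ : Type*} {f : (ι → ℂ) → κ → ℂ} {g : (ι → ℂ) → μ → ℂ} {c : ℝ}
    (h : HasCost f c) (hg : ∀ m, ∃ k, ∀ x, f x k = g x m) : HasCost g c := by
  choose e he using hg
  exact (h.outputs e).congr fun x m => he m x

/-- Applying the same map to each vector of a family. -/
theorem batch {ι κ : Type*} {f : (ι → ℂ) → κ → ℂ} {c : ℝ} (h : HasCost f c) (β : Type*)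
    [Fintype β] : HasCost (fun (x : ι × β → ℂ) (p : κ × β) => f (fun i => x (i, p.2)) p.1)
      (Fintype.card β * c) := by
  have := of_partition (f := fun (x : ι × β → ℂ) (p : κ × β) => f (fun i => x (i, p.2)) p.1)
    Prod.snd (fun _ => c) fun j => by
      refine (h.comp_free (f := fun (x : ι × β → ℂ) i => x (i, j)) fun i =>
        .input (i, j)).of_forall_exists ?_
      rintro ⟨⟨k, j⟩, rfl⟩
      exact ⟨k, fun x => rfl⟩
  simpa using this

end HasCost

theorem CompleteIrreps.dft_apply {G : Type*} [Group G] [Fintype G] (R : CompleteIrreps G)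
    (c : G → ℂ) (i : Fin R.num) (a b : Fin (R.dim i)) :
    R.dft c ⟨i, a, b⟩ = ∑ g, c g * R.rep i g a b := by
  simp [CompleteIrreps.dft, Matrix.sum_apply]

/-- The generalized DFTs of a family of vectors. -/
noncomputable def CompleteIrreps.batchDft {G : Type*} [Group G] [Fintype G] (R : CompleteIrreps G)
    (β : Type*) (x : G × β → ℂ) (p : R.Entries × β) : ℂ :=
  R.dft (fun g => x (g, p.2)) p.1

/-- `d ≤ √g` implies `d ^ (τ - 2) ≤ g ^ (τ / 2 - 1)`. -/
theorem rpow_le_rpow_of_sq_le {d g τ : ℝ} (hd : 0 ≤ d) (h : d ^ 2 ≤ g) (hτ : 2 ≤ τ) :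
    d ^ (τ - 2) ≤ g ^ (τ / 2 - 1) := by
  have h1 : d ^ (τ - 2) = (d ^ 2) ^ (τ / 2 - 1) := by
    rw [← Real.rpow_natCast, ← Real.rpow_mul hd]
    congr 1
    push_cast
    ring
  rw [h1]
  exact Real.rpow_le_rpow (by positivity) h (by linarith)

theorem sum_reverse {A B C D : Type*} [Fintype A] [Fintype B] [Fintype C] [Fintype D]
    (F : A → B → C → D → ℂ) :
    ∑ a, ∑ b, ∑ c, ∑ d, F a b c d = ∑ d, ∑ c, ∑ b, ∑ a, F a b c d := by
  simp only [← Fintype.sum_prod_type']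
  let e : A × B × C × D ≃ D × C × B × A :=
    ⟨fun p => (p.2.2.2, p.2.2.1, p.2.1, p.1), fun p => (p.2.2.2, p.2.2.1, p.2.1, p.1),
      fun _ => rfl, fun _ => rfl⟩
  exact Fintype.sum_equiv e _ _ fun _ => rfl

namespace MatMulBound

variable {b τ : ℝ}

/-- A family of sufficiently many DFTs is computed well enough by multiplying with the matrix
of the DFT. -/
theorem batchDft (hM : MatMulBound b τ) {G : Type*} [Group G] [Fintype G] (R : CompleteIrreps G)
    (β : Type*) [Fintype β] :
    HasCost (R.batchDft β) (b * (Fintype.card β * Fintype.card G + (Fintype.card G : ℝ) ^ 2)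
      * (Fintype.card G : ℝ) ^ (τ - 2)) := by
  refine (hM.product_wide R.card_entries_le (β := β)
    (P := fun (z : R.Entries) g (_ : G × β → ℂ) => R.rep z.1 g z.2.1 z.2.2)
    (Q := fun g j (x : G × β → ℂ) => x (g, j)) (fun i k => .const _)
    (fun k j => .input _)).congr ?_
  rintro x ⟨⟨i, a, c⟩, j⟩
  simp only [CompleteIrreps.batchDft, CompleteIrreps.dft_apply, mul_comm]

/-- Multiplying a square matrix by constant matrices on both sides. -/
theorem sandwich (hM : MatMulBound b τ) {α β : Type*} [Fintype α] [Fintype β] {d : ℕ}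
    (hα : Fintype.card α = d) (hβ : Fintype.card β = d) (S : Matrix (Fin d) α ℂ)
    (T : Matrix β (Fin d) ℂ) :
    HasCost (fun (Y : α × β → ℂ) (p : Fin d × Fin d) =>
      (S * Matrix.of (fun i j => Y (i, j)) * T) p.1 p.2) (2 * (b * (d : ℝ) ^ τ)) := by
  have h1 := hM.product_le_card (ι := α × β) (α := α) (δ := β) (β := Fin d)
    (by rw [hα, hβ]) (by rw [Fintype.card_fin, hβ])
    (P := fun i k Y => Y (i, k)) (Q := fun k j _ => T k j)
    (fun i k => .input (i, k)) (fun k j => .const _)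
  have h2 := hM.product_le_card (ι := α × Fin d) (α := Fin d) (δ := α) (β := Fin d)
    (by rw [Fintype.card_fin, hα]) (by rw [Fintype.card_fin, hα])
    (P := fun i k _ => S i k) (Q := fun k j Y => Y (k, j))
    (fun k j => .const _) (fun i k => .input (i, k))
  rw [hβ] at h1
  rw [hα] at h2
  refine ((h2.comp h1).congr fun Y p => ?_).mono (le_of_eq (by ring))
  rw [Matrix.mul_assoc]
  simp only [Matrix.mul_apply, Matrix.of_apply]

/-- Multiplying a family of square matrices by constant matrices on both sides. -/
theorem sandwichFamily (hM : MatMulBound b τ) {I : Type*} [Fintype I] (dim : I → ℕ)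
    (hpos : ∀ r, 0 < dim r) {g : ℝ} (hdim : ∑ r, (dim r : ℝ) ^ 2 ≤ g) {α β : I → Type*}
    [∀ r, Fintype (α r)] [∀ r, Fintype (β r)] (hα : ∀ r, Fintype.card (α r) = dim r)
    (hβ : ∀ r, Fintype.card (β r) = dim r) (S : ∀ r, Matrix (Fin (dim r)) (α r) ℂ)
    (T : ∀ r, Matrix (β r) (Fin (dim r)) ℂ) :
    HasCost (fun (Y : (Σ r, α r × β r) → ℂ) (p : Σ r, Fin (dim r) × Fin (dim r)) =>
      (S p.1 * Matrix.of (fun i j => Y ⟨p.1, i, j⟩) * T p.1) p.2.1 p.2.2)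
      (2 * b * g ^ (τ / 2)) := by
  have hτ := hM.two_le
  have hb := hM.nonneg
  have hcost : ∀ r, HasCost (fun (Y : (Σ r, α r × β r) → ℂ) (p : Fin (dim r) × Fin (dim r)) =>
      (S r * Matrix.of (fun i j => Y ⟨r, i, j⟩) * T r) p.1 p.2) (2 * (b * (dim r : ℝ) ^ τ)) :=
    fun r => (hM.sandwich (hα r) (hβ r) (S r) (T r)).comp_free
      (f := fun (Y : (Σ r, α r × β r) → ℂ) p => Y ⟨r, p⟩) fun k => .input _
  refine (HasCost.sigma (κ := fun r => Fin (dim r) × Fin (dim r)) _ hcost).mono ?_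
  have hg0 : 0 ≤ g := le_trans (by positivity) hdim
  calc ∑ r, 2 * (b * (dim r : ℝ) ^ τ)
      ≤ ∑ r, 2 * (b * ((dim r : ℝ) ^ 2 * g ^ (τ / 2 - 1))) := by
        refine Finset.sum_le_sum fun r _ => ?_
        have hr : (0 : ℝ) < dim r := by exact_mod_cast hpos r
        have h1 : (dim r : ℝ) ^ τ = (dim r : ℝ) ^ 2 * (dim r : ℝ) ^ (τ - 2) := by
          rw [← Real.rpow_natCast, ← Real.rpow_add hr]; norm_num
        rw [h1]
        gcongr
        refine rpow_le_rpow_of_sq_le hr.le (le_trans ?_ hdim) hτ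
        exact Finset.single_le_sum (f := fun r => (dim r : ℝ) ^ 2)
          (fun i _ => by positivity) (Finset.mem_univ r)
    _ = 2 * b * ((∑ r, (dim r : ℝ) ^ 2) * g ^ (τ / 2 - 1)) := by
        rw [Finset.sum_mul, Finset.mul_sum]
        exact Finset.sum_congr rfl fun r _ => by ring
    _ ≤ 2 * b * (g * g ^ (τ / 2 - 1)) := by gcongr
    _ = 2 * b * g ^ (τ / 2) := by
        rw [← Real.rpow_one_add' hg0 (by linarith)]
        congr 2
        ring

/-- Let `y` be the DFT of a function `c` on `H × K`.  Writing `σ` for the representations in `RH`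
and `π` for those in `RK`, this is the cost of computing from `y` the matrices
`∑ c(h, k) (⨁ σ(h)) M (⨁ π(k))`. Each pair `(σ, π)` contributes the product of a constant matrix
with a square matrix of size `dim σ * dim π` holding entries of `y`. -/
theorem blockTransform (hM : MatMulBound b τ) {H K : Type*} [Group H] [Fintype H] [Group K]
    [Fintype K] (RH : CompleteIrreps H) (RK : CompleteIrreps K) {g : ℝ}
    (hHK : (Fintype.card H * Fintype.card K : ℝ) ≤ g)
    {I : Type*} [Fintype I] (dim : I → ℕ) (hdim : ∑ r, (dim r : ℝ) ^ 2 ≤ g)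
    (μ : I → Fin RH.num → Type) [∀ r i, Fintype (μ r i)]
    (ν : I → Fin RK.num → Type) [∀ r i, Fintype (ν r i)]
    (hμ : ∀ r, Fintype.card (Σ i, μ r i × Fin (RH.dim i)) = dim r)
    (hν : ∀ r, Fintype.card (Σ i, ν r i × Fin (RK.dim i)) = dim r)
    (M : ∀ r, Matrix (Σ i, μ r i × Fin (RH.dim i)) (Σ i, ν r i × Fin (RK.dim i)) ℂ) :
    HasCost (fun (y : RK.Entries × RH.Entries → ℂ)
      (p : Σ r, (Σ i, μ r i × Fin (RH.dim i)) × (Σ i, ν r i × Fin (RK.dim i))) =>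
        ∑ t : Fin (RH.dim p.2.1.1) × Fin (RK.dim p.2.2.1),
          M p.1 ⟨p.2.1.1, p.2.1.2.1, t.1⟩ ⟨p.2.2.1, p.2.2.2.1, t.2⟩ *
            y (⟨p.2.2.1, t.2, p.2.2.2.2⟩, ⟨p.2.1.1, p.2.1.2.2, t.1⟩))
      (2 * b * g ^ (τ / 2)) := by
  have hτ := hM.two_le
  have hb := hM.nonneg
  have hH := RH.sum_dim_sq_le
  have hK := RK.sum_dim_sq_le
  have hcard : ∀ q : Fin RH.num × Fin RK.num,
      (RH.dim q.1 * RK.dim q.2 : ℝ) ^ 2 ≤ Fintype.card H * Fintype.card K := by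
    intro q
    rw [mul_pow]
    have h1 : (RH.dim q.1 : ℝ) ^ 2 ≤ Fintype.card H := by
      exact_mod_cast (Finset.single_le_sum (fun i _ => Nat.zero_le _) (Finset.mem_univ q.1)).trans hH
    have h2 : (RK.dim q.2 : ℝ) ^ 2 ≤ Fintype.card K := by
      exact_mod_cast (Finset.single_le_sum (fun i _ => Nat.zero_le _) (Finset.mem_univ q.2)).trans hK
    gcongr
  refine (HasCost.of_partition (fun p => (p.2.1.1, p.2.2.1))
    (fun q : Fin RH.num × Fin RK.num =>
      b * (((∑ r, Fintype.card (μ r q.1) * Fintype.card (ν r q.2) : ℕ) : ℝ) *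
        (RH.dim q.1 * RK.dim q.2) + (RH.dim q.1 * RK.dim q.2 : ℝ) ^ 2) *
        (RH.dim q.1 * RK.dim q.2 : ℝ) ^ (τ - 2)) ?_).mono ?_
  · rintro ⟨i, j⟩
    have := hM.product_tall (ι := RK.Entries × RH.Entries) (α := Σ r, μ r i × ν r j)
      (δ := Fin (RH.dim i) × Fin (RK.dim j)) (β := Fin (RH.dim i) × Fin (RK.dim j)) le_rfl
      (P := fun p t _ => M p.1 ⟨i, p.2.1, t.1⟩ ⟨j, p.2.2, t.2⟩)
      (Q := fun t u y => y (⟨j, t.2, u.2⟩, ⟨i, u.1, t.1⟩))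
      (fun _ _ => .const _) (fun _ _ => .input _)
    refine (this.of_forall_exists ?_).mono (le_of_eq ?_)
    · rintro ⟨⟨r, ⟨i', p, a⟩, ⟨j', p', c⟩⟩, h⟩
      simp only [Prod.mk.injEq] at h
      obtain ⟨rfl, rfl⟩ := h
      exact ⟨(⟨r, p, p'⟩, (a, c)), fun y => rfl⟩
    · simp
  · have hsum : ∑ q : Fin RH.num × Fin RK.num,
        ((∑ r, Fintype.card (μ r q.1) * Fintype.card (ν r q.2) : ℕ) : ℝ) *
        (RH.dim q.1 * RK.dim q.2) = ∑ r, (dim r : ℝ) ^ 2 := by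
      push_cast
      simp only [Finset.sum_mul]
      rw [Finset.sum_comm]
      refine Finset.sum_congr rfl fun r _ => ?_
      have h1 : (dim r : ℝ) = ∑ i, (Fintype.card (μ r i) : ℝ) * RH.dim i := by
        rw [← hμ r]; simp
      have h2 : (dim r : ℝ) = ∑ i, (Fintype.card (ν r i) : ℝ) * RK.dim i := by
        rw [← hν r]; simp
      rw [sq]
      nth_rewrite 1 [h1]
      rw [h2, Finset.sum_mul_sum, Fintype.sum_prod_type]
      refine Finset.sum_congr rfl fun i _ => Finset.sum_congr rfl fun j _ => ?_
      ring
    have hsum2 : ∑ q : Fin RH.num × Fin RK.num, (RH.dim q.1 * RK.dim q.2 : ℝ) ^ 2 ≤ g := by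
      rw [Fintype.sum_prod_type]
      simp only [mul_pow, ← Finset.mul_sum, ← Finset.sum_mul]
      refine le_trans ?_ hHK
      have h1 : ∑ i, (RH.dim i : ℝ) ^ 2 ≤ Fintype.card H := by exact_mod_cast hH
      have h2 : ∑ i, (RK.dim i : ℝ) ^ 2 ≤ Fintype.card K := by exact_mod_cast hK
      gcongr
    have hg : 0 < g := lt_of_lt_of_le (by positivity) hHK
    calc _ ≤ ∑ q : Fin RH.num × Fin RK.num,
          b * (((∑ r, Fintype.card (μ r q.1) * Fintype.card (ν r q.2) : ℕ) : ℝ) *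
        (RH.dim q.1 * RK.dim q.2) + (RH.dim q.1 * RK.dim q.2 : ℝ) ^ 2) * g ^ (τ / 2 - 1) := by
          refine Finset.sum_le_sum fun q _ => ?_
          gcongr
          exact rpow_le_rpow_of_sq_le (by positivity) ((hcard q).trans hHK) hτ
      _ ≤ b * (g + g) * g ^ (τ / 2 - 1) := by
          rw [← Finset.sum_mul, ← Finset.mul_sum, Finset.sum_add_distrib]
          gcongr
          exact hsum.trans_le hdim
      _ = 2 * b * g ^ (τ / 2) := by
          rw [Real.rpow_sub_one hg.ne']
          field_simp
          ring

/-- The double subgroup reduction: a function on `H × K` is pushed forward to `G` along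
`(h, k) ↦ w φ(h) ψ(k)` and the DFT is applied, for each member of a family of such functions. -/
theorem doubleReduction (hM : MatMulBound b τ) {G H K : Type*} [Group G] [Fintype G] [Group H]
    [Fintype H] [Group K] [Fintype K] (R : CompleteIrreps G) (RH : CompleteIrreps H)
    (RK : CompleteIrreps K) (φ : H →* G) (ψ : K →* G)
    (hHK : Fintype.card H * Fintype.card K ≤ Fintype.card G) (β : Type*) [Fintype β] {cH cK : ℝ}
    (hH : HasCost (RH.batchDft (K × β)) cH) (hK : HasCost (RK.batchDft (RH.Entries × β)) cK)
    (w : G) :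
    HasCost (fun (x : (H × K) × β → ℂ) (p : R.Entries × β) => ∑ h, ∑ k,
        x ((h, k), p.2) * R.rep p.1.1 (w * φ h * ψ k) p.1.2.1 p.1.2.2)
      (cH + cK + Fintype.card β * (4 * b * (Fintype.card G : ℝ) ^ (τ / 2))) := by
  have hτ := hM.two_le
  have hb := hM.nonneg
  set g : ℝ := (Fintype.card G : ℝ) with hg
  have hg0 : 0 < g := by rw [hg]; positivity
  have hdim : ∑ r, (R.dim r : ℝ) ^ 2 ≤ g := by
    rw [hg]; exact_mod_cast R.sum_dim_sq_le
  have hHK' : (Fintype.card H * Fintype.card K : ℝ) ≤ g := by rw [hg]; exact_mod_cast hHK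
  choose μ hμF S T hμ hST using fun r => RH.exists_conj_sumRep ((R.rep r).comp φ)
  choose ν hνF S' T' hν hST' using fun r => RK.exists_conj_sumRep ((R.rep r).comp ψ)
  -- the coordinates in the two adapted bases
  have hblock := hM.blockTransform RH RK hHK' R.dim hdim μ ν hμ hν fun r => T r * S' r
  -- back to the given bases, including the translation by `w`
  have hback := hM.sandwichFamily R.dim R.dim_pos hdim hμ hν (fun r => R.rep r w * S r) T'
  have h1 : HasCost (fun (x : (H × K) × β → ℂ) =>
      RH.batchDft (K × β) fun q => x ((q.1, q.2.1), q.2.2)) cH :=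
    hH.comp_free fun k => .input _
  have h2 : HasCost (fun (y : RH.Entries × (K × β) → ℂ) =>
      RK.batchDft (RH.Entries × β) fun q => y (q.2.1, (q.1, q.2.2))) cK :=
    hK.comp_free fun k => .input _
  have h3 := ((hback.comp hblock).batch β).comp_free
    (f := fun (y : RK.Entries × (RH.Entries × β) → ℂ) (q : (RK.Entries × RH.Entries) × β) =>
      y (q.1.1, (q.1.2, q.2))) fun k => .input _
  refine ((h3.comp (h2.comp h1)).congr ?_).mono (le_of_eq (by ring))
  rintro x ⟨⟨r, a, c⟩, j⟩
  have hrep : ∀ h k, R.rep r (w * φ h * ψ k) = R.rep r w * S r *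
      (RH.sumRep (μ r) h * (T r * S' r) * RK.sumRep (ν r) k) * T' r := by
    intro h k
    have e1 : R.rep r (φ h) = S r * RH.sumRep (μ r) h * T r := hST r h
    have e2 : R.rep r (ψ k) = S' r * RK.sumRep (ν r) k * T' r := hST' r k
    rw [map_mul, map_mul, e1, e2]
    simp only [Matrix.mul_assoc]
  have hmain : (∑ h, ∑ k, x ((h, k), j) • R.rep r (w * φ h * ψ k)) =
      R.rep r w * S r * (∑ h, ∑ k, x ((h, k), j) •
        (RH.sumRep (μ r) h * (T r * S' r) * RK.sumRep (ν r) k)) * T' r := by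
    simp only [hrep, Matrix.mul_sum, Matrix.sum_mul, Matrix.mul_smul, Matrix.smul_mul]
  have hentry := congrFun (congrFun hmain a) c
  simp only [Matrix.sum_apply, Matrix.smul_apply, smul_eq_mul] at hentry
  refine Eq.trans ?_ hentry.symm
  refine congrFun (congrFun (congrArg (fun N => R.rep r w * S r * N * T' r) ?_) a) c
  ext ⟨i, p, a⟩ ⟨i', p', a'⟩
  simp only [Matrix.of_apply, CompleteIrreps.batchDft, CompleteIrreps.dft_apply, Matrix.sum_apply,
    Matrix.smul_apply, smul_eq_mul, CompleteIrreps.mul_sumRep_apply,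
    CompleteIrreps.sumRep_mul_apply, Finset.sum_mul, Finset.mul_sum, Fintype.sum_prod_type]
  rw [sum_reverse]
  refine Finset.sum_congr rfl fun h _ => Finset.sum_congr rfl fun k _ =>
    Finset.sum_congr rfl fun b' _ => Finset.sum_congr rfl fun a' _ => ?_
  ring

/-- If `G` is covered by translates `w φ(H) ψ(K)`, its DFT is a sum of translated double subgroup
reductions. -/
theorem batchDft_of_cover (hM : MatMulBound b τ) {G H K : Type*} [Group G] [Fintype G] [Group H]
    [Fintype H] [Group K] [Fintype K] (R : CompleteIrreps G) (RH : CompleteIrreps H)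
    (RK : CompleteIrreps K) (φ : H →* G) (ψ : K →* G)
    (hHK : Fintype.card H * Fintype.card K ≤ Fintype.card G) {L : Type*} [Fintype L] (w : L → G)
    (hw : ∀ g, ∃ i h k, w i * φ h * ψ k = g) (β : Type*) [Fintype β] {cH cK : ℝ}
    (hH : HasCost (RH.batchDft (K × β)) cH) (hK : HasCost (RK.batchDft (RH.Entries × β)) cK) :
    HasCost (R.batchDft β) (Fintype.card L * (cH + cK +
      Fintype.card β * ((4 * b + 1) * (Fintype.card G : ℝ) ^ (τ / 2)))) := by
  classical
  have hτ := hM.two_le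
  choose i h k hw using hw
  -- each element of `G` is used in only one of its factorizations
  let X : L → (G × β → ℂ) → (H × K) × β → ℂ := fun l x q =>
    if i (w l * φ q.1.1 * ψ q.1.2) = l ∧ h (w l * φ q.1.1 * ψ q.1.2) = q.1.1 ∧
      k (w l * φ q.1.1 * ψ q.1.2) = q.1.2 then x (w l * φ q.1.1 * ψ q.1.2, q.2) else 0
  have hX : ∀ l q, IsInputOrConst fun x => X l x q := by
    intro l q
    by_cases hq : i (w l * φ q.1.1 * ψ q.1.2) = l ∧ h (w l * φ q.1.1 * ψ q.1.2) = q.1.1 ∧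
      k (w l * φ q.1.1 * ψ q.1.2) = q.1.2
    · simpa only [X, if_pos hq] using .input _
    · simpa only [X, if_neg hq] using .const 0
  let Y : L → (G × β → ℂ) → R.Entries × β → ℂ := fun l x p => ∑ h', ∑ k',
    X l x ((h', k'), p.2) * R.rep p.1.1 (w l * φ h' * ψ k') p.1.2.1 p.1.2.2
  have hY : ∀ l : L, HasCost (Y l)
      (cH + cK + Fintype.card β * (4 * b * (Fintype.card G : ℝ) ^ (τ / 2))) := fun l =>
    (hM.doubleReduction R RH RK φ ψ hHK β hH hK (w l)).comp_free (hX l)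
  refine ((HasCost.sum Finset.univ hY).congr ?_).mono ?_
  · rintro x ⟨⟨r, a, c⟩, j⟩
    simp only [Y, X]
    simp only [CompleteIrreps.batchDft, CompleteIrreps.dft_apply, ← Fintype.sum_prod_type']
    refine (Fintype.sum_of_injective (fun g => (i g, (h g, k g))) ?_ _ _ ?_ ?_).symm
    · intro g g' hgg
      simp only [Prod.mk.injEq] at hgg
      rw [← hw g, ← hw g', hgg.1, hgg.2.1, hgg.2.2]
    · rintro ⟨l, h', k'⟩ hq
      rw [if_neg, zero_mul]
      rintro ⟨h1, h2, h3⟩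
      exact hq ⟨_, Prod.ext h1 (Prod.ext h2 h3)⟩
    · intro g
      simp [hw]
  · simp only [Finset.sum_const, Finset.card_univ, nsmul_eq_mul, Fintype.card_prod]
    have h1 : (Fintype.card R.Entries : ℝ) ≤ (Fintype.card G : ℝ) ^ (τ / 2) := by
      calc (Fintype.card R.Entries : ℝ) ≤ Fintype.card G := by exact_mod_cast R.card_entries_le
        _ = (Fintype.card G : ℝ) ^ (1 : ℝ) := (Real.rpow_one _).symm
        _ ≤ _ := Real.rpow_le_rpow_of_exponent_le (by exact_mod_cast Fintype.card_pos)
          (by linarith)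
    push_cast
    have h2 : (Fintype.card R.Entries : ℝ) * Fintype.card β ≤
        Fintype.card β * (Fintype.card G : ℝ) ^ (τ / 2) := by
      rw [mul_comm]; gcongr
    refine mul_le_mul_of_nonneg_left ?_ (by positivity)
    linarith

/-- The DFT of a group `G` that is covered by a set of `|L|` translates `w A N V`, where `A`, `N`
and `V` are groups mapped to `G`, `A` and `N` by way of a group `P` that is the product of their
images. The size conditions say that no product has more elements than the group containing it,
and that the sizes of `A`, `N` and `V` are at most about `√|G|`. -/
theorem dft_of_triple_cover (hM : MatMulBound b τ) {G P A N V : Type*} [Group G] [Fintype G]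
    [Group P] [Fintype P] [Group A] [Fintype A] [Group N] [Fintype N] [Group V] [Fintype V]
    (R : CompleteIrreps G) (θ : P →* G) (α : A →* P) (ν : N →* P) (ψ : V →* G)
    (hP : ∀ p, ∃ n a, ν n * α a = p) {L : Type*} [Fintype L] (w : L → G)
    (hw : ∀ g, ∃ i p v, w i * θ p * ψ v = g)
    (hNA : Fintype.card N * Fintype.card A ≤ Fintype.card P)
    (hPV : Fintype.card P * Fintype.card V ≤ Fintype.card G)
    (hNV : Fintype.card N = Fintype.card V) (hA : Fintype.card A ≤ Fintype.card V ^ 2) :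
    HasCost R.dft ((14 * b + 2) * Fintype.card L * (Fintype.card G : ℝ) ^ (τ / 2)) := by
  obtain ⟨RP⟩ := nonempty_completeIrreps (G := P)
  obtain ⟨RA⟩ := nonempty_completeIrreps (G := A)
  obtain ⟨RN⟩ := nonempty_completeIrreps (G := N)
  obtain ⟨RV⟩ := nonempty_completeIrreps (G := V)
  have hτ := hM.two_le
  have hb := hM.nonneg
  -- the DFT of `P`, for `|V|` vectors
  have h1 := hM.batchDft_of_cover (L := Unit) RP RN RA ν α hNA (fun _ => 1)
    (fun p => by simpa using hP p) (V × Unit) (hM.batchDft RN _) (hM.batchDft RA _)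
  have h2 := (hM.batchDft_of_cover R RP RV θ ψ hPV w hw Unit h1 (hM.batchDft RV _))
  have h3 := (h2.comp_free (f := fun (x : G → ℂ) q => x q.1) fun q => .input _).outputs
    fun z => (z, ())
  refine h3.mono ?_
  have eA : Fintype.card RN.Entries ≤ Fintype.card N := RN.card_entries_le
  have eP : Fintype.card RP.Entries ≤ Fintype.card P := RP.card_entries_le
  simp only [Fintype.card_prod, Fintype.card_unit, Nat.cast_one, mul_one, one_mul, Nat.cast_mul]
  rw [hNV] at hNA eA ⊢
  generalize Fintype.card RN.Entries = n at eA ⊢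
  generalize Fintype.card RP.Entries = m at eP ⊢
  have ha1 : 1 ≤ Fintype.card A := Fintype.card_pos
  have hu1 : 1 ≤ Fintype.card V := Fintype.card_pos
  have hg1 : 0 < Fintype.card G := Fintype.card_pos
  generalize Fintype.card A = a at *
  generalize Fintype.card V = u at *
  generalize Fintype.card P = p at *
  generalize Fintype.card G = g at *
  have hau : u * a * u ≤ g := (Nat.mul_le_mul_right u hNA).trans hPV
  have huu : u ^ 2 ≤ g := le_trans (by nlinarith [Nat.mul_le_mul_left (u * u) ha1]) hau
  have haa : a ^ 2 ≤ g := le_trans (by nlinarith [Nat.mul_le_mul_left a hA]) hau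
  have hnua : n * a * u ≤ g := le_trans (by gcongr) hau
  have hmu : m * u ≤ g := (Nat.mul_le_mul_right u eP).trans hPV
  have hg0 : (0 : ℝ) < g := by exact_mod_cast hg1
  have hsplit : (g : ℝ) ^ (τ / 2) = g * (g : ℝ) ^ (τ / 2 - 1) := by
    rw [Real.rpow_sub_one hg0.ne']; field_simp
  have key : ∀ s t : ℕ, s ≤ g → t ^ 2 ≤ g →
      b * ((s : ℝ) + (t : ℝ) ^ 2) * (t : ℝ) ^ (τ - 2) ≤ 2 * b * (g : ℝ) ^ (τ / 2) := by
    intro s t hs ht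
    have hs' : (s : ℝ) ≤ g := by exact_mod_cast hs
    have ht' : (t : ℝ) ^ 2 ≤ g := by exact_mod_cast ht
    calc b * ((s : ℝ) + (t : ℝ) ^ 2) * (t : ℝ) ^ (τ - 2)
        ≤ b * ((g : ℝ) + g) * (g : ℝ) ^ (τ / 2 - 1) := by
          gcongr
          exact rpow_le_rpow_of_sq_le (by positivity) ht' hτ
      _ = _ := by rw [hsplit]; ring
  have k1 := key (a * u * u) u (le_trans (le_of_eq (by ring)) hau) huu
  have k2 := key (n * u * a) a (le_trans (le_of_eq (by ring)) hnua) haa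
  have k3 := key (m * u) u hmu huu
  have k4 : (u : ℝ) * (p : ℝ) ^ (τ / 2) ≤ (g : ℝ) ^ (τ / 2) := by
    calc (u : ℝ) * (p : ℝ) ^ (τ / 2) ≤ (u : ℝ) ^ (τ / 2) * (p : ℝ) ^ (τ / 2) := by
          gcongr
          exact Real.self_le_rpow_of_one_le (by exact_mod_cast hu1) (by linarith)
      _ = ((u : ℝ) * p) ^ (τ / 2) := (Real.mul_rpow (by positivity) (by positivity)).symm
      _ ≤ _ := by
          refine Real.rpow_le_rpow (by positivity) ?_ (by linarith)
          rw [mul_comm]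
          exact_mod_cast hPV
  push_cast at k1 k2 k3
  have k5 := mul_le_mul_of_nonneg_left k4 (show (0 : ℝ) ≤ 4 * b + 1 by linarith)
  rw [mul_comm (14 * b + 2), mul_assoc (Fintype.card L : ℝ)]
  refine mul_le_mul_of_nonneg_left ?_ (by positivity)
  nlinarith [k1, k2, k3, k5]

end MatMulBound

/-! ### The Siegel parabolic of the symplectic group -/

namespace Siegel

open Matrix

variable (l F : Type*) [Fintype l] [DecidableEq l] [Field F]

/-- The additive group of symmetric matrices. -/
def symmetricMatrices : AddSubgroup (Matrix l l F) where
  carrier := {X | Xᵀ = X}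
  zero_mem' := Matrix.transpose_zero
  add_mem' {X Y} hX hY := by
    simp only [Set.mem_ofPred_eq] at hX hY ⊢
    rw [Matrix.transpose_add, hX, hY]
  neg_mem' {X} hX := by
    simp only [Set.mem_ofPred_eq] at hX ⊢
    rw [Matrix.transpose_neg, hX]

/-- The abelian group of symmetric matrices under addition, written multiplicatively. -/
abbrev SymMatrix : Type _ := Multiplicative (symmetricMatrices l F)

variable {l F}

/-- The symmetric matrix underlying an element of `SymMatrix l F`. -/
def SymMatrix.mat (X : SymMatrix l F) : Matrix l l F := (Multiplicative.toAdd X).1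

omit [Fintype l] [DecidableEq l] in
theorem SymMatrix.transpose_mat (X : SymMatrix l F) : X.matᵀ = X.mat := (Multiplicative.toAdd X).2

omit [Fintype l] [DecidableEq l] in
theorem SymMatrix.mat_mul (X Y : SymMatrix l F) : (X * Y).mat = X.mat + Y.mat := rfl

omit [Fintype l] [DecidableEq l] in
theorem SymMatrix.mat_one : (1 : SymMatrix l F).mat = 0 := rfl

omit [Fintype l] [DecidableEq l] in
theorem SymMatrix.mat_injective : Function.Injective (SymMatrix.mat : SymMatrix l F → Matrix l l F) :=
  fun _ _ h => Subtype.ext h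

theorem mem_symplecticGroup_fromBlocks {A B C D : Matrix l l F} :
    fromBlocks A B C D ∈ symplecticGroup l F ↔
      B * Aᵀ = A * Bᵀ ∧ A * Dᵀ - B * Cᵀ = 1 ∧ D * Aᵀ - C * Bᵀ = 1 ∧ D * Cᵀ = C * Dᵀ := by
  rw [SymplecticGroup.mem_iff, J, fromBlocks_transpose, fromBlocks_multiply, fromBlocks_multiply,
    fromBlocks_inj]
  simp only [Matrix.mul_zero, Matrix.mul_one, Matrix.mul_neg, zero_add, add_zero, Matrix.neg_mul]
  refine and_congr ?_ (and_congr ?_ (and_congr ?_ ?_))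
  · rw [← sub_eq_add_neg, sub_eq_zero]
  · rw [← neg_inj, neg_neg, neg_add, neg_neg, sub_eq_add_neg, add_comm]
  · rw [← sub_eq_add_neg]
  · rw [← sub_eq_add_neg, sub_eq_zero]

theorem symm_of_mem {A B C D : Matrix l l F} (h : fromBlocks A B C D ∈ symplecticGroup l F) :
    Dᵀ * B = Bᵀ * D := by
  have := SymplecticGroup.transpose_mem h
  rw [fromBlocks_transpose, mem_symplecticGroup_fromBlocks] at this
  simpa using this.2.2.2

/-- The unipotent matrices `[[1, X], [0, 1]]`. -/
def upper : SymMatrix l F →* symplecticGroup l F where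
  toFun X := ⟨fromBlocks 1 X.mat 0 1, by
    rw [mem_symplecticGroup_fromBlocks]; simp [X.transpose_mat]⟩
  map_one' := Subtype.ext (by simp [SymMatrix.mat_one])
  map_mul' X Y := Subtype.ext (by simp [SymMatrix.mat_mul, fromBlocks_multiply, add_comm])

/-- The unipotent matrices `[[1, 0], [Y, 1]]`. -/
def lower : SymMatrix l F →* symplecticGroup l F where
  toFun Y := ⟨fromBlocks 1 0 Y.mat 1, by
    rw [mem_symplecticGroup_fromBlocks]; simp [Y.transpose_mat]⟩
  map_one' := Subtype.ext (by simp [SymMatrix.mat_one])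
  map_mul' X Y := Subtype.ext (by simp [SymMatrix.mat_mul, fromBlocks_multiply, add_comm])

/-- The block-diagonal matrices `[[D⁻ᵀ, 0], [0, D]]`. -/
def levi : GL l F →* symplecticGroup l F where
  toFun D := ⟨fromBlocks (D⁻¹).1ᵀ 0 0 D.1, by
    rw [mem_symplecticGroup_fromBlocks]
    have h1 : D.1 * (D⁻¹).1 = 1 := D.mul_inv
    simp only [Matrix.transpose_zero, Matrix.mul_zero, Matrix.zero_mul, sub_zero,
      and_true, Matrix.transpose_transpose, ← Matrix.transpose_mul, h1, Matrix.transpose_one]⟩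
  map_one' := Subtype.ext (by simp)
  map_mul' D E := Subtype.ext (by
    simp only [Submonoid.coe_mul, fromBlocks_multiply, _root_.mul_inv_rev, Units.val_mul,
      Matrix.transpose_mul, Matrix.mul_zero, Matrix.zero_mul, add_zero, zero_add])

/-- The Siegel parabolic: the symplectic matrices `[[A, B], [0, D]]`. -/
def parabolic (l F : Type*) [Fintype l] [DecidableEq l] [Field F] :
    Subgroup (symplecticGroup l F) where
  carrier := {g | g.1.toBlocks₂₁ = 0}
  one_mem' := by
    simp only [Set.mem_ofPred_eq, Submonoid.coe_one, ← fromBlocks_one, toBlocks_fromBlocks₂₁]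
  mul_mem' {g h} hg hh := by
    simp only [Set.mem_ofPred_eq, Submonoid.coe_mul] at hg hh ⊢
    rw [← fromBlocks_toBlocks g.1, ← fromBlocks_toBlocks h.1, fromBlocks_multiply,
      toBlocks_fromBlocks₂₁, hg, hh]
    simp
  inv_mem' {g} hg := by
    simp only [Set.mem_ofPred_eq, SymplecticGroup.coe_inv] at hg ⊢
    rw [← fromBlocks_toBlocks g.1, J, fromBlocks_transpose, fromBlocks_neg, fromBlocks_multiply,
      fromBlocks_multiply, toBlocks_fromBlocks₂₁, hg]
    simp

theorem mem_parabolic {g : symplecticGroup l F} : g ∈ parabolic l F ↔ g.1.toBlocks₂₁ = 0 := Iff.rfl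

theorem upper_mem (X : SymMatrix l F) : upper X ∈ parabolic l F := toBlocks_fromBlocks₂₁ _ _ _ _

theorem levi_mem (D : GL l F) : levi D ∈ parabolic l F := toBlocks_fromBlocks₂₁ _ _ _ _

theorem lower_mem_iff {Y : SymMatrix l F} : lower Y ∈ parabolic l F ↔ Y = 1 := by
  have : (lower Y).1.toBlocks₂₁ = Y.mat := toBlocks_fromBlocks₂₁ _ _ _ _
  rw [mem_parabolic, this]
  exact ⟨fun h => SymMatrix.mat_injective h, fun h => h ▸ rfl⟩

theorem upper_mul_levi (X : SymMatrix l F) (D : GL l F) :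
    (upper X * levi D).1 = fromBlocks (D⁻¹).1ᵀ (X.mat * D.1) 0 D.1 := by
  change fromBlocks 1 X.mat 0 1 * fromBlocks (D⁻¹).1ᵀ 0 0 D.1 = _
  simp [fromBlocks_multiply]

/-- The open cell: a symplectic matrix `[[A, B], [C, D]]` with `D` invertible is the product of
`[[1, B D⁻¹], [0, 1]]`, `[[D⁻ᵀ, 0], [0, D]]` and `[[1, 0], [D⁻¹ C, 1]]`. -/
theorem exists_upper_levi_lower (g : symplecticGroup l F) (hD : IsUnit g.1.toBlocks₂₂.det) :
    ∃ (X : SymMatrix l F) (D : GL l F) (Y : SymMatrix l F), g = upper X * levi D * lower Y := by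
  obtain ⟨g, hg⟩ := g
  obtain ⟨A, B, C, D, rfl⟩ : ∃ A B C D, g = fromBlocks A B C D :=
    ⟨_, _, _, _, (fromBlocks_toBlocks g).symm⟩
  simp only [toBlocks_fromBlocks₂₂] at hD
  have hDB := symm_of_mem hg
  obtain ⟨-, hAD, -, hDC⟩ := mem_symplecticGroup_fromBlocks.mp hg
  have hDT : IsUnit Dᵀ.det := by rwa [Matrix.det_transpose]
  have hX : (B * D⁻¹)ᵀ = B * D⁻¹ := by
    rw [Matrix.transpose_mul, Matrix.transpose_nonsing_inv]
    calc (Dᵀ)⁻¹ * Bᵀ = (Dᵀ)⁻¹ * (Bᵀ * D) * D⁻¹ := by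
          rw [Matrix.mul_assoc, Matrix.mul_assoc, Matrix.mul_nonsing_inv _ hD, Matrix.mul_one]
      _ = B * D⁻¹ := by
          rw [← hDB, ← Matrix.mul_assoc, Matrix.nonsing_inv_mul _ hDT, Matrix.one_mul]
  have hY : (D⁻¹ * C)ᵀ = D⁻¹ * C := by
    rw [Matrix.transpose_mul, Matrix.transpose_nonsing_inv]
    calc Cᵀ * (Dᵀ)⁻¹ = D⁻¹ * (D * Cᵀ) * (Dᵀ)⁻¹ := by
          rw [← Matrix.mul_assoc, Matrix.nonsing_inv_mul _ hD, Matrix.one_mul]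
      _ = D⁻¹ * C := by
          rw [hDC, Matrix.mul_assoc, Matrix.mul_assoc, Matrix.mul_nonsing_inv _ hDT, Matrix.mul_one]
  refine ⟨Multiplicative.ofAdd ⟨_, hX⟩, Matrix.GeneralLinearGroup.mk'' D hD,
    Multiplicative.ofAdd ⟨_, hY⟩, Subtype.ext ?_⟩
  rw [Submonoid.coe_mul, upper_mul_levi]
  change fromBlocks A B C D = fromBlocks (D⁻¹)ᵀ (B * D⁻¹ * D) 0 D * fromBlocks 1 0 (D⁻¹ * C) 1
  rw [fromBlocks_multiply]
  simp only [Matrix.mul_one, Matrix.mul_zero, zero_add]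
  rw [Matrix.mul_assoc B, Matrix.nonsing_inv_mul _ hD, Matrix.mul_one, ← Matrix.mul_assoc D,
    Matrix.mul_nonsing_inv _ hD, Matrix.one_mul]
  congr 1
  calc A = A * Dᵀ * (Dᵀ)⁻¹ := by rw [Matrix.mul_assoc, Matrix.mul_nonsing_inv _ hDT, Matrix.mul_one]
    _ = (1 + B * Cᵀ) * (Dᵀ)⁻¹ := by rw [← hAD]; simp
    _ = (D⁻¹)ᵀ + B * (D⁻¹ * C) := by
      rw [Matrix.add_mul, Matrix.one_mul, Matrix.transpose_nonsing_inv, Matrix.mul_assoc, ← hY,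
        Matrix.transpose_mul, Matrix.transpose_nonsing_inv]

theorem exists_upper_levi (g : symplecticGroup l F) (hg : g ∈ parabolic l F) :
    ∃ (X : SymMatrix l F) (D : GL l F), upper X * levi D = g := by
  have hD : IsUnit g.1.toBlocks₂₂.det := by
    have h := g.2
    rw [← fromBlocks_toBlocks g.1, mem_symplecticGroup_fromBlocks, mem_parabolic.mp hg] at h
    have h1 := h.2.1
    rw [Matrix.transpose_zero, Matrix.mul_zero, sub_zero] at h1
    have h2 := congrArg Matrix.det h1
    rw [Matrix.det_mul, Matrix.det_transpose, Matrix.det_one, mul_comm] at h2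
    exact IsUnit.of_mul_eq_one _ h2
  obtain ⟨X, D, Y, h⟩ := exists_upper_levi_lower g hD
  have hY : lower Y ∈ parabolic l F := by
    have : lower Y = (upper X * levi D)⁻¹ * g := by rw [h]; group
    rw [this]
    exact mul_mem (inv_mem (mul_mem (upper_mem X) (levi_mem D))) hg
  rw [lower_mem_iff] at hY
  exact ⟨X, D, by rw [h, hY, map_one, mul_one]⟩

/-! ### Covering by translates of the open cell -/

/-- The columns of `[B; D]` span a Lagrangian subspace.  It is complementary to one of the
coordinate Lagrangians: one can choose for each `i` the `i`-th row of `B` or of `D` so that the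
chosen rows form an injective map. -/
theorem exists_transversal (B D : Matrix l l F) (hBD : Dᵀ * B = Bᵀ * D)
    (hinj : ∀ x, B *ᵥ x = 0 → D *ᵥ x = 0 → x = 0) :
    ∃ S : Finset l, ∀ x, (∀ i ∈ S, (D *ᵥ x) i = 0) → (∀ i ∉ S, (B *ᵥ x) i = 0) → x = 0 := by
  classical
  -- a minimal set of rows of `D` that is injective on the kernel of `B`
  let good : Finset l → Prop := fun T => ∀ x, B *ᵥ x = 0 → (∀ i ∈ T, (D *ᵥ x) i = 0) → x = 0
  have hex : ∃ T, good T := ⟨Finset.univ, fun x h1 h2 => hinj x h1 (funext fun i => h2 i (by simp))⟩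
  obtain ⟨T, hT, hmin⟩ := wellFounded_lt.has_min {T | good T} hex
  refine ⟨T, fun x hD hB => ?_⟩
  have hBx : B *ᵥ x = 0 := by
    funext i
    by_cases hi : i ∈ T
    · have hne : ¬ good (T.erase i) := fun h => hmin _ h (Finset.erase_ssubset hi)
      simp only [good] at hne
      push Not at hne
      obtain ⟨y, hBy, hDy, hy⟩ := hne
      have hyi : (D *ᵥ y) i ≠ 0 := fun h => hy (hT y hBy fun j hj => by
        by_cases hji : j = i
        · rw [hji, h]
        · exact hDy j (Finset.mem_erase.mpr ⟨hji, hj⟩))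
      have h1 : (B *ᵥ x) ⬝ᵥ (D *ᵥ y) = 0 := by
        rw [Matrix.dotProduct_mulVec, Matrix.vecMul_mulVec, ← hBD, ← Matrix.vecMul_mulVec,
          ← Matrix.dotProduct_mulVec, hBy, dotProduct_zero]
      have h2 : (B *ᵥ x) ⬝ᵥ (D *ᵥ y) = (B *ᵥ x) i * (D *ᵥ y) i := by
        refine Finset.sum_eq_single i (fun j _ hj => ?_) (by simp)
        by_cases hjT : j ∈ T
        · rw [hDy j (Finset.mem_erase.mpr ⟨hj, hjT⟩), mul_zero]
        · rw [hB j hjT, zero_mul]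
      exact (mul_eq_zero.mp (h2.symm.trans h1)).resolve_right hyi
    · exact hB i hi
  exact hT x hBx hD

/-- The signed permutation matrix that exchanges the coordinates `i` of the two halves for `i` not
in `S`. -/
def exchange (S : Finset l) : symplecticGroup l F :=
  ⟨fromBlocks (diagonal fun i => if i ∈ S then 1 else 0) (-diagonal fun i => if i ∈ S then 0 else 1)
    (diagonal fun i => if i ∈ S then 0 else 1) (diagonal fun i => if i ∈ S then 1 else 0), by
    rw [mem_symplecticGroup_fromBlocks]
    simp only [Matrix.diagonal_transpose, Matrix.transpose_neg, Matrix.neg_mul, Matrix.mul_neg,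
      Matrix.diagonal_mul_diagonal, sub_neg_eq_add, Matrix.diagonal_add]
    refine ⟨?_, ?_, ?_, ?_⟩
    · congr 2; funext i; split_ifs <;> simp
    · rw [← Matrix.diagonal_one]; congr 1; funext i; split_ifs <;> simp
    · rw [← Matrix.diagonal_one]; congr 1; funext i; split_ifs <;> simp
    · congr 1; funext i; split_ifs <;> simp⟩

/-- Left multiplication by `exchange S` moves a symplectic matrix into the open cell, for some `S`. -/
theorem exists_exchange_mul_isUnit (g : symplecticGroup l F) :
    ∃ S : Finset l, IsUnit (exchange S * g).1.toBlocks₂₂.det := by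
  obtain ⟨g, hg⟩ := g
  obtain ⟨A, B, C, D, rfl⟩ : ∃ A B C D, g = fromBlocks A B C D :=
    ⟨_, _, _, _, (fromBlocks_toBlocks g).symm⟩
  have hT := SymplecticGroup.transpose_mem hg
  rw [fromBlocks_transpose, mem_symplecticGroup_fromBlocks] at hT
  have h1 := hT.2.1
  simp only [Matrix.transpose_transpose] at h1
  obtain ⟨S, hS⟩ := exists_transversal B D (symm_of_mem hg) fun x hB hD => by
    have := congrArg (· *ᵥ x) h1
    simpa [Matrix.sub_mulVec, ← Matrix.mulVec_mulVec, hB, hD] using this.symm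
  refine ⟨S, ?_⟩
  have hblock : (exchange S * ⟨fromBlocks A B C D, hg⟩ : symplecticGroup l F).1.toBlocks₂₂ =
      (diagonal fun i => if i ∈ S then 0 else 1) * B +
        (diagonal fun i => if i ∈ S then 1 else 0) * D := by
    rw [Submonoid.coe_mul, exchange, fromBlocks_multiply, toBlocks_fromBlocks₂₂]
  rw [hblock, ← Matrix.isUnit_iff_isUnit_det, ← Matrix.mulVec_injective_iff_isUnit]
  refine (injective_iff_map_eq_zero (Matrix.mulVecLin _)).mpr fun x hx => hS x (fun i hi => ?_)
    (fun i hi => ?_)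
  · have := congrFun hx i
    simpa [Matrix.add_mulVec, ← Matrix.mulVec_mulVec, Matrix.mulVec_diagonal, hi] using this
  · have := congrFun hx i
    simpa [Matrix.add_mulVec, ← Matrix.mulVec_mulVec, Matrix.mulVec_diagonal, hi] using this

theorem exists_cover (g : symplecticGroup l F) :
    ∃ (S : Finset l) (p : parabolic l F) (Y : SymMatrix l F),
      (exchange S)⁻¹ * (p : symplecticGroup l F) * lower Y = g := by
  obtain ⟨S, hS⟩ := exists_exchange_mul_isUnit g
  obtain ⟨X, D, Y, h⟩ := exists_upper_levi_lower _ hS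
  refine ⟨S, ⟨upper X * levi D, mul_mem (upper_mem X) (levi_mem D)⟩, Y, ?_⟩
  rw [mul_assoc, ← h, inv_mul_cancel_left]

/-! ### Cardinalities -/

variable [Finite F]

instance : Finite (GL l F) := Finite.of_injective (fun D => D.1) Units.val_injective

instance : Finite (SymMatrix l F) := Finite.of_injective _ SymMatrix.mat_injective

theorem card_symMatrix_mul_card_GL_le :
    Nat.card (SymMatrix l F) * Nat.card (GL l F) ≤ Nat.card (parabolic l F) := by
  rw [← Nat.card_prod]
  refine Nat.card_le_card_of_injective (fun q => (⟨upper q.1 * levi q.2,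
    mul_mem (upper_mem q.1) (levi_mem q.2)⟩ : parabolic l F)) ?_
  rintro ⟨X, D⟩ ⟨X', D'⟩ h
  have h1 := congrArg (fun p => p.1.1) h
  simp only [upper_mul_levi, fromBlocks_inj] at h1
  obtain ⟨-, hX, -, hD⟩ := h1
  obtain rfl : D = D' := Units.ext hD
  have : X.mat = X'.mat := by
    have h2 := congrArg (· * (D⁻¹).1) hX
    simpa [Matrix.mul_assoc, ← Units.val_mul] using h2
  rw [SymMatrix.mat_injective this]

theorem card_parabolic_mul_card_symMatrix_le :
    Nat.card (parabolic l F) * Nat.card (SymMatrix l F) ≤ Nat.card (symplecticGroup l F) := by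
  rw [← Nat.card_prod]
  refine Nat.card_le_card_of_injective (fun q => q.1.1 * lower q.2) ?_
  rintro ⟨p, Y⟩ ⟨p', Y'⟩ h
  simp only at h
  have h1 : lower (Y * Y'⁻¹) = p.1⁻¹ * p'.1 := by
    rw [map_mul, map_inv, eq_inv_mul_iff_mul_eq, ← mul_assoc, h, mul_inv_cancel_right]
  have h2 : lower (Y * Y'⁻¹) ∈ parabolic l F := h1 ▸ mul_mem (inv_mem p.2) p'.2
  obtain rfl : Y = Y' := mul_inv_eq_one.mp (lower_mem_iff.mp h2)
  rw [Subtype.ext (mul_right_cancel h)]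

omit [DecidableEq l] in
/-- A square matrix is determined by the symmetric matrices that agree with it above and below
the diagonal. -/
theorem card_matrix_le_card_symMatrix_sq [LinearOrder l] :
    Nat.card (Matrix l l F) ≤ Nat.card (SymMatrix l F) ^ 2 := by
  rw [sq, ← Nat.card_prod]
  have h1 : ∀ X : Matrix l l F, (Matrix.of fun i j => X (min i j) (max i j)) ∈
      symmetricMatrices l F := fun X => by
    ext i j
    simp [min_comm, max_comm]
  have h2 : ∀ X : Matrix l l F, (Matrix.of fun i j => X (max i j) (min i j)) ∈
      symmetricMatrices l F := fun X => by
    ext i j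
    simp [min_comm, max_comm]
  refine Nat.card_le_card_of_injective (fun X => (Multiplicative.ofAdd ⟨_, h1 X⟩,
    Multiplicative.ofAdd ⟨_, h2 X⟩)) fun X Y h => ?_
  simp only [Prod.mk.injEq, EmbeddingLike.apply_eq_iff_eq, Subtype.mk.injEq] at h
  ext i j
  rcases le_total i j with hij | hij
  · simpa [hij] using congrFun (congrFun h.1 i) j
  · simpa [hij] using congrFun (congrFun h.2 i) j

theorem card_GL_le_card_symMatrix_sq [LinearOrder l] :
    Nat.card (GL l F) ≤ Nat.card (SymMatrix l F) ^ 2 :=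
  (Nat.card_le_card_of_injective (fun D : GL l F => D.1) Units.val_injective).trans
    card_matrix_le_card_symMatrix_sq

theorem two_pow_le_card_symMatrix_sq (n : ℕ) :
    2 ^ n ^ 2 ≤ Nat.card (SymMatrix (Fin n) F) ^ 2 := by
  refine le_trans ?_ card_matrix_le_card_symMatrix_sq
  have : Nat.card (Matrix (Fin n) (Fin n) F) = Nat.card F ^ n ^ 2 := by
    rw [Matrix, Nat.card_fun, Nat.card_fun]
    simp [sq, pow_mul]
  rw [this]
  exact Nat.pow_le_pow_left Finite.one_lt_card _

/-! ### The antidiagonal form -/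

/-- Reversing the order of the last `n` coordinates turns the antidiagonal blocks of the form into
identity matrices. -/
def revEquiv (n : ℕ) : Fin n ⊕ Fin n ≃ Fin n ⊕ Fin n := Equiv.sumCongr (Equiv.refl _) Fin.revPerm

omit [Finite F] in
theorem sympForm_submatrix (n : ℕ) :
    (sympForm n F).submatrix (revEquiv n) (revEquiv n) = -J (Fin n) F := by
  ext (i | i) (j | j) <;>
    simp [sympForm, revEquiv, J, antidiagOne, Matrix.one_apply, eq_comm, Fin.rev_eq_iff]

omit [Finite F] in
theorem submatrix_mem_symplecticGroup_iff {n : ℕ}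
    (A : Matrix (Fin n ⊕ Fin n) (Fin n ⊕ Fin n) F) :
    A.submatrix (revEquiv n) (revEquiv n) ∈ symplecticGroup (Fin n) F ↔
      Aᵀ * sympForm n F * A = sympForm n F := by
  rw [SymplecticGroup.mem_iff']
  have h1 : J (Fin n) F = -(sympForm n F).submatrix (revEquiv n) (revEquiv n) := by
    rw [sympForm_submatrix, neg_neg]
  rw [h1, Matrix.mul_neg, Matrix.neg_mul, neg_inj, Matrix.transpose_submatrix,
    Matrix.submatrix_mul_equiv, Matrix.submatrix_mul_equiv]
  exact (Matrix.reindex (revEquiv n).symm (revEquiv n).symm).injective.eq_iff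
    (a := Aᵀ * sympForm n F * A) (b := sympForm n F)

omit [Finite F] in
/-- The symplectic group of the antidiagonal form is isomorphic to that of the standard form. -/
theorem nonempty_mulEquiv_Sp (n : ℕ) : Nonempty (symplecticGroup (Fin n) F ≃* Sp n F) := by
  let f : Sp n F →* symplecticGroup (Fin n) F :=
    { toFun := fun A => ⟨A.1.1.submatrix (revEquiv n) (revEquiv n),
        (submatrix_mem_symplecticGroup_iff _).mpr A.2⟩
      map_one' := Subtype.ext (by simp)
      map_mul' := fun A B => Subtype.ext (by simp) }
  refine ⟨(MulEquiv.ofBijective f ⟨fun A B h => ?_, fun B => ?_⟩).symm⟩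
  · have h1 := congrArg Subtype.val h
    exact Subtype.ext (Units.ext
      ((Matrix.reindex (revEquiv n).symm (revEquiv n).symm).injective h1))
  · let A := B.1.submatrix (revEquiv n).symm (revEquiv n).symm
    have hA : A.submatrix (revEquiv n) (revEquiv n) = B.1 := by simp [A]
    have hdet : IsUnit A.det := by
      rw [Matrix.det_submatrix_equiv_self]
      exact SymplecticGroup.symplectic_det B.2
    refine ⟨⟨Matrix.GeneralLinearGroup.mk'' A hdet, ?_⟩, Subtype.ext hA⟩
    exact (submatrix_mem_symplecticGroup_iff A).mp (hA ▸ B.2)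

end Siegel

/-! ### The generalized DFT of the symplectic group -/

/-- The number `2 ^ n` of translates is negligible against a group with at least `2 ^ (n ^ 2)`
elements. -/
theorem two_pow_le_mul_rpow {δ : ℝ} (hδ : 0 < δ) {n g : ℕ} (hg : 2 ^ n ^ 2 ≤ g) :
    (2 : ℝ) ^ n ≤ 2 ^ (1 / δ) * (g : ℝ) ^ δ := by
  have hg' : ((2 : ℝ)) ^ ((n : ℝ) ^ 2) ≤ g := by
    have : ((2 ^ n ^ 2 : ℕ) : ℝ) ≤ g := by exact_mod_cast hg
    refine le_trans (le_of_eq ?_) this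
    exact_mod_cast Real.rpow_natCast 2 (n ^ 2)
  have h1 : (1 : ℝ) ≤ 2 ^ (1 / δ) := Real.one_le_rpow (by norm_num) (by positivity)
  have hg1 : (1 : ℝ) ≤ g := le_trans (Real.one_le_rpow (by norm_num) (by positivity)) hg'
  have h2 : (1 : ℝ) ≤ (g : ℝ) ^ δ := Real.one_le_rpow hg1 hδ.le
  rw [← Real.rpow_natCast]
  rcases le_total ((n : ℝ)) (1 / δ) with h | h
  · calc (2 : ℝ) ^ (n : ℝ) ≤ 2 ^ (1 / δ) := Real.rpow_le_rpow_of_exponent_le (by norm_num) h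
      _ ≤ _ := le_mul_of_one_le_right (by positivity) h2
  · have h3 : (n : ℝ) ≤ (n : ℝ) ^ 2 * δ := by
      have h4 : 1 ≤ n * δ := (div_le_iff₀ hδ).mp h
      nlinarith [(Nat.cast_nonneg n : (0 : ℝ) ≤ n)]
    calc (2 : ℝ) ^ (n : ℝ) ≤ 2 ^ ((n : ℝ) ^ 2 * δ) :=
          Real.rpow_le_rpow_of_exponent_le (by norm_num) h3
      _ = ((2 : ℝ) ^ ((n : ℝ) ^ 2)) ^ δ := Real.rpow_mul (by norm_num) _ _
      _ ≤ (g : ℝ) ^ δ := Real.rpow_le_rpow (by positivity) hg' hδ.le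
      _ ≤ _ := le_mul_of_one_le_left (by positivity) h1

theorem two_pow_sq_le_card_Sp (n : ℕ) (F : Type*) [Field F] [Finite F] :
    2 ^ n ^ 2 ≤ Nat.card (Sp n F) := by
  obtain ⟨f⟩ := Siegel.nonempty_mulEquiv_Sp (F := F) n
  rw [← Nat.card_congr f.toEquiv]
  have h1 := Siegel.card_symMatrix_mul_card_GL_le (l := Fin n) (F := F)
  have h2 := Siegel.card_parabolic_mul_card_symMatrix_le (l := Fin n) (F := F)
  have h3 : 1 ≤ Nat.card (Matrix.GeneralLinearGroup (Fin n) F) := Nat.card_pos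
  refine (Siegel.two_pow_le_card_symMatrix_sq (F := F) n).trans (le_trans ?_ h2)
  rw [sq]
  exact Nat.mul_le_mul_right _ ((Nat.le_mul_of_pos_right _ h3).trans h1)

theorem MatMulBound.dft_Sp {b τ : ℝ} (hM : MatMulBound b τ) (n : ℕ) (F : Type*) [Field F]
    [Finite F] (R : CompleteIrreps (Sp n F)) :
    HasCost R.dft ((14 * b + 2) * 2 ^ n * (Nat.card (Sp n F) : ℝ) ^ (τ / 2)) := by
  obtain ⟨f⟩ := Siegel.nonempty_mulEquiv_Sp (F := F) n
  have : Fintype (Siegel.parabolic (Fin n) F) := Fintype.ofFinite _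
  have : Fintype (Matrix.GeneralLinearGroup (Fin n) F) := Fintype.ofFinite _
  have : Fintype (Siegel.SymMatrix (Fin n) F) := Fintype.ofFinite _
  refine (hM.dft_of_triple_cover R (f.toMonoidHom.comp (Siegel.parabolic (Fin n) F).subtype)
    (Siegel.levi.codRestrict _ Siegel.levi_mem) (Siegel.upper.codRestrict _ Siegel.upper_mem)
    (f.toMonoidHom.comp Siegel.lower) (fun p => ?_)
    (fun S : Finset (Fin n) => f (Siegel.exchange S)⁻¹) (fun g => ?_) ?_ ?_ rfl ?_).mono ?_
  · obtain ⟨X, D, h⟩ := Siegel.exists_upper_levi p.1 p.2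
    exact ⟨X, D, Subtype.ext h⟩
  · obtain ⟨S, p, Y, h⟩ := Siegel.exists_cover (f.symm g)
    refine ⟨S, p, Y, ?_⟩
    rw [← f.apply_symm_apply g, ← h, map_mul, map_mul]
    rfl
  · simpa only [Nat.card_eq_fintype_card] using
      Siegel.card_symMatrix_mul_card_GL_le (l := Fin n) (F := F)
  · rw [← Nat.card_eq_fintype_card (α := Sp n F), ← Nat.card_congr f.toEquiv]
    simpa only [Nat.card_eq_fintype_card] using
      Siegel.card_parabolic_mul_card_symMatrix_le (l := Fin n) (F := F)
  · simpa only [Nat.card_eq_fintype_card] using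
      Siegel.card_GL_le_card_symMatrix_sq (l := Fin n) (F := F)
  · rw [Nat.card_eq_fintype_card]
    simp

theorem theorem5p6 :
    ∀ ε : ℝ, 0 < ε → ∃ C : ℝ, ∀ (n : ℕ) (F : Type*) [Field F] [Finite F],
      Nonempty (CompleteIrreps (Sp n F)) ∧
      ∀ R : CompleteIrreps (Sp n F), ∃ (s : ℕ) (P : Circuit (Sp n F) s),
        P.Computes R.dft ∧
        (s : ℝ) ≤ C * (Nat.card (Sp n F) : ℝ) ^ (matMulExponent / 2 + ε) := by
  intro ε hε
  obtain ⟨b, τ, hM, hτ⟩ := exists_matMulBound hε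
  have hb := hM.nonneg
  refine ⟨(14 * b + 2) * 2 ^ (1 / (ε / 2)), fun n F _ _ => ⟨nonempty_completeIrreps, fun R => ?_⟩⟩
  refine (hM.dft_Sp n F R).mono ?_
  have h2 := two_pow_le_mul_rpow (half_pos hε) (two_pow_sq_le_card_Sp n F)
  have hg : (1 : ℝ) ≤ Nat.card (Sp n F) := by exact_mod_cast Nat.card_pos
  generalize (Nat.card (Sp n F) : ℝ) = g at h2 hg ⊢
  have hg0 : 0 < g := by linarith
  calc (14 * b + 2) * 2 ^ n * g ^ (τ / 2)
      ≤ (14 * b + 2) * (2 ^ (1 / (ε / 2)) * g ^ (ε / 2)) * g ^ (matMulExponent / 2 + ε / 2) := by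
        gcongr
        linarith
    _ = (14 * b + 2) * 2 ^ (1 / (ε / 2)) * (g ^ (ε / 2) * g ^ (matMulExponent / 2 + ε / 2)) := by
        ring
    _ = _ := by
        rw [← Real.rpow_add hg0]
        congr 2
        ring
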